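/- Conventions. A dcpo is a poset in which every nonempty directed subset has a supremum; Scott-continuous maps preserve these suprema. Write $x\ll y$ if every directed $A$ with $y\le\sup A$ contains some $a\ge x$. A dcpo $D$ is continuous (a domain) if there is $B\subseteq D$ such that for every $x\in D$ the set $\{b\in B: b\ll x\}$ is directed with supremum $x$. A pointed barycentric algebra is a set $A$ with a point $\bot$ and operations $a+_r b$ ($r\in[0,1]$) such that $a+_1b=a$, $a+_rb=b+_{1-r}a$, $a+_ra=a$, and $(a+_pb)+_rc=a+_{pr}\bigl(b+_{\frac{r-pr}{1-pr}}c\bigr)$ for $r,p<1$. A map is linear if it preserves $\bot$ and all $+_r$. For $r_i\in[0,1]$ with $\sum_{i=1}^n r_i\le 1$, define $\sum_{i=1}^n r_ia_i$ inductively: it is $\bot$ if $n=0$, $a_1$ if $r_1=1$, and $a_1+_{r_1}\bigl(\sum_{i=2}^n\frac{r_i}{1-r_1}a_i\bigr)$ if $r_1<1$. A Kegelspitze is a pointed barycentric algebra $K$ with a dcpo order such that $(a,b)\mapsto a+_rb$, for each $r$, and $(r,a)\mapsto a+_r\bot$ are Scott-continuous on $K\times K$ and $[0,1]\times K$. It is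 continuous if its dcpo is continuous. For a dcpo $D$, let $\mathcal V D$ be the set of Scott-continuous maps $\nu$ from the lattice of Scott-open subsets of $D$ to $[0,1]$ with $\nu(\emptyset)=0$ and $\nu(U)+\nu(V)=\nu(U\cup V)+\nu(U\cap V)$, ordered pointwise. A simple valuation is a finite (possibly empty) sum $\sum_i r_i\delta_{x_i}$ with $r_i\ge 0$, $\sum_i r_i\le1$, where $\delta_x(U)=1$ if $x\in U$ and $0$ otherwise. Let $\mathcal M D\subseteq \mathcal V D$ be the intersection of all subsets of $\mathcal V D$ that are closed under directed suprema and contain the simple valuations. $\mathcal M D$ is a pointed barycentric algebra under $\nu+_r\xi=r\nu+(1-r)\xi$ with the zero valuation as point. $\mathcal M$ is a monad on the category of dcpos and Scott-continuous maps, with $\mathcal M(h)(\nu)(U)=\nu(h^{-1}(U))$, unit $\eta_D(x)=\delta_x$ and multiplication $\mu_D(\varpi)(U)=\int_{\nu\in\mathcal M D}\nu(U)\,d\varpi$, where $\int f\,d\varpi=\int_0^1\varpi(f^{-1}((t,1]))\,dt$. Proposition. For every continuous Kegelspitze $K$ there is a map $\beta\colon\mathcal M K\to K$ such that: 1. $\beta$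 is Scott-continuous, and for every $\nu\in\mathcal M K$ the supremum of the set of all $\sum_i r_ix_i$, where $\sum_i r_i\delta_{x_i}$ ranges over the simple valuations with $\sum_i r_i\delta_{x_i}\ll\nu$ in $\mathcal M K$, exists and equals $\beta(\nu)$; 2. $\beta\bigl(\sum_i r_i\delta_{x_i}\bigr)=\sum_i r_ix_i$ for every simple valuation on $K$ (in particular, the right-hand side depends only on the valuation); 3. $\beta$ is linear; 4. $(K,\beta)$ is an Eilenberg–Moore algebra of $\mathcal M$: $\beta\circ\eta_K=\mathrm{id}_K$ and $\beta\circ\mu_K=\beta\circ\mathcal M(\beta)$. -/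

import Mathlib

open Set Topology TopologicalSpace CategoryTheory
open scoped unitInterval

universe u

namespace Kegel

noncomputable section

/-! ### Dcpos, domains, the category of dcpos -/

/-- A dcpo: every nonempty directed subset has a supremum. -/
class IsDcpo (D : Type*) [PartialOrder D] : Prop where
  exists_isLUB : ∀ A : Set D, A.Nonempty → DirectedOn (· ≤ ·) A → ∃ x, IsLUB A x

/-- `x` is way-below `y`. -/
def WayBelow {D : Type*} [PartialOrder D] (x y : D) : Prop :=
  ∀ A : Set D, A.Nonempty → DirectedOn (· ≤ ·) A → ∀ s, IsLUB A s → y ≤ s → ∃ a ∈ A, x ≤ a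

/-- A domain (continuous dcpo): a dcpo that has a basis. -/
class IsDomainDcpo (D : Type*) [PartialOrder D] : Prop extends IsDcpo D where
  exists_basis : ∃ B : Set D, ∀ x : D, {b | b ∈ B ∧ WayBelow b x}.Nonempty ∧
    DirectedOn (· ≤ ·) {b | b ∈ B ∧ WayBelow b x} ∧ IsLUB {b | b ∈ B ∧ WayBelow b x} x

/-- Bundled dcpos. -/
structure DCPO where
  carrier : Type u
  [order : PartialOrder carrier]
  [isDcpo : IsDcpo carrier]

attribute [instance] DCPO.order DCPO.isDcpo

/-- Scott-continuous maps. -/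
@[ext]
structure DCPO.Hom (D E : DCPO.{u}) where
  toFun : D.carrier → E.carrier
  scottContinuous : ScottContinuous toFun

/-- The category of dcpos and Scott-continuous maps. -/
instance : Category DCPO.{u} where
  Hom := DCPO.Hom
  id D := ⟨fun x => x, ScottContinuous.id⟩
  comp f g := ⟨fun x => g.toFun (f.toFun x), f.scottContinuous.comp g.scottContinuous⟩

/-! ### Barycentric algebras and Kegelspitzen -/

/-- A pointed barycentric algebra; `mix r a b` is `a +_r b`. -/
class PointedBarycentricAlgebra (A : Type*) where
  mix : I → A → A → A
  pt : A
  mix_one : ∀ a b, mix 1 a b = a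
  mix_symm : ∀ r a b, mix r a b = mix (σ r) b a
  mix_self : ∀ r a, mix r a a = a
  mix_assoc : ∀ (r p q : I) (a b c : A), r < 1 → p < 1 →
    (q : ℝ) = ((r : ℝ) - p * r) / (1 - p * r) →
    mix r (mix p a b) c = mix (p * r) a (mix q b c)

open PointedBarycentricAlgebra

/-- A linear map between pointed barycentric algebras. -/
def IsLinear {A B : Type*} [PointedBarycentricAlgebra A] [PointedBarycentricAlgebra B]
    (f : A → B) : Prop :=
  f pt = pt ∧ ∀ (r : I) (a b : A), f (mix r a b) = mix r (f a) (f b)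

/-- A Kegelspitze; scalar multiplication is `r · a = a +_r ⊥`. -/
class IsKegelspitze (K : Type*) [PartialOrder K] [PointedBarycentricAlgebra K] : Prop
    extends IsDcpo K where
  mix_scottContinuous : ∀ r : I, ScottContinuous fun p : K × K => mix r p.1 p.2
  smul_scottContinuous : ScottContinuous fun p : I × K => mix p.1 p.2 pt

/-- The convex sum `∑ r_i a_i`, for `∑ r_i ≤ 1`, by recursion on the number of summands. The
quotient `r_i / (1 - r_1)` lies in `[0,1]` when `∑ r_i ≤ 1` and `r_1 < 1`, so that the projection
to `[0,1]` does nothing in this case. The empty sum is the distinguished point. -/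
def convexSum {A : Type*} [PointedBarycentricAlgebra A] : {n : ℕ} → (Fin n → I) → (Fin n → A) → A
  | 0, _, _ => pt
  | _ + 1, r, a =>
    open Classical in
    if r 0 = 1 then a 0
    else mix (r 0) (a 0)
      (convexSum (fun i => projIcc (0 : ℝ) 1 zero_le_one ((r i.succ : ℝ) / (1 - r 0)))
        fun i => a i.succ)

/-! ### Auxiliary facts on suprema of real families -/

lemma isLUB_coe {s : Set I} (hs : s.Nonempty) {a : I} :
    IsLUB ((fun x : I => (x : ℝ)) '' s) (a : ℝ) ↔ IsLUB s a := by
  constructor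
  · intro h
    refine ⟨fun x hx => h.1 ⟨x, hx, rfl⟩, fun c hc => ?_⟩
    exact h.2 (by rintro _ ⟨x, hx, rfl⟩; exact hc hx)
  · intro h
    refine ⟨by rintro _ ⟨x, hx, rfl⟩; exact h.1 hx, fun c hc => ?_⟩
    by_cases h1 : c ≤ 1
    · obtain ⟨x, hx⟩ := hs
      have h0 : 0 ≤ c := x.2.1.trans (hc ⟨x, hx, rfl⟩)
      exact h.2 (show (⟨c, h0, h1⟩ : I) ∈ upperBounds s from fun y hy => hc ⟨y, hy, rfl⟩)
    · exact a.2.2.trans (not_le.1 h1).le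

lemma isLUB_coe_image {α : Type*} {d : Set α} (hd : d.Nonempty) {f : α → I} {a : I} :
    IsLUB ((fun x => (f x : ℝ)) '' d) (a : ℝ) ↔ IsLUB (f '' d) a := by
  rw [← isLUB_coe (hd.image f), image_image]

lemma scottContinuous_coe {α : Type*} [Preorder α] {f : α → I} :
    ScottContinuous (fun x => (f x : ℝ)) ↔ ScottContinuous f :=
  ⟨fun h _ h0 h1 _ h2 => (isLUB_coe_image h0).1 (h h0 h1 h2),
    fun h _ h0 h1 _ h2 => (isLUB_coe_image h0).2 (h h0 h1 h2)⟩

lemma isLUB_add {α : Type*} [Preorder α] {d : Set α} (hd : DirectedOn (· ≤ ·) d)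
    {f g : α → ℝ} (hf : Monotone f) (hg : Monotone g) {a b : ℝ}
    (ha : IsLUB (f '' d) a) (hb : IsLUB (g '' d) b) :
    IsLUB ((fun x => f x + g x) '' d) (a + b) := by
  refine ⟨by rintro _ ⟨x, hx, rfl⟩; exact add_le_add (ha.1 ⟨x, hx, rfl⟩) (hb.1 ⟨x, hx, rfl⟩),
    fun c hc => ?_⟩
  have h1 : ∀ x ∈ d, ∀ y ∈ d, f x + g y ≤ c := by
    intro x hx y hy
    obtain ⟨z, hz, hxz, hyz⟩ := hd x hx y hy
    exact (add_le_add (hf hxz) (hg hyz)).trans (hc ⟨z, hz, rfl⟩)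
  have h2 : ∀ y ∈ d, a ≤ c - g y := fun y hy =>
    ha.2 (by rintro _ ⟨x, hx, rfl⟩; linarith [h1 x hx y hy])
  have h3 : b ≤ c - a := hb.2 (by rintro _ ⟨y, hy, rfl⟩; linarith [h2 y hy])
  linarith

lemma isLUB_const_mul {α : Type*} {d : Set α} (hd : d.Nonempty) {f : α → ℝ} {a r : ℝ}
    (hr : 0 ≤ r) (ha : IsLUB (f '' d) a) : IsLUB ((fun x => r * f x) '' d) (r * a) := by
  refine ⟨by rintro _ ⟨x, hx, rfl⟩; exact mul_le_mul_of_nonneg_left (ha.1 ⟨x, hx, rfl⟩) hr,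
    fun c hc => ?_⟩
  rcases hr.eq_or_lt with rfl | hr
  · obtain ⟨x, hx⟩ := hd
    simpa using hc ⟨x, hx, rfl⟩
  · rw [← le_div_iff₀' hr]
    refine ha.2 ?_
    rintro _ ⟨x, hx, rfl⟩
    rw [le_div_iff₀' hr]
    exact hc ⟨x, hx, rfl⟩

lemma isLUB_const {α : Type*} {d : Set α} (hd : d.Nonempty) (c : ℝ) :
    IsLUB ((fun _ : α => c) '' d) c := by
  rw [hd.image_const]; exact isLUB_singleton

lemma isLUB_sum {α ι : Type*} [Preorder α] {d : Set α} (h0 : d.Nonempty)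
    (hd : DirectedOn (· ≤ ·) d) (s : Finset ι) {f : ι → α → ℝ} (hf : ∀ i, Monotone (f i))
    {a : ι → ℝ} (ha : ∀ i, IsLUB (f i '' d) (a i)) :
    IsLUB ((fun x => ∑ i ∈ s, f i x) '' d) (∑ i ∈ s, a i) := by
  classical
  induction s using Finset.induction_on with
  | empty => simpa using isLUB_const h0 0
  | insert i s hi ih =>
    simp only [Finset.sum_insert hi]
    exact isLUB_add hd (hf i) (fun x y h => Finset.sum_le_sum fun j _ => hf j h) (ha i) ih

/-- Directed suprema of antitone functions commute with the integral over `[0,1]`. -/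
lemma isLUB_integral {α : Type*} [Preorder α] {d : Set α} (h0 : d.Nonempty)
    (hd : DirectedOn (· ≤ ·) d) {G : α → ℝ → ℝ} (hG : ∀ x, Antitone (G x))
    (hm : ∀ t, Monotone fun x => G x t) {g : ℝ → ℝ}
    (hl : ∀ t, IsLUB ((fun x => G x t) '' d) (g t)) :
    IsLUB ((fun x => ∫ t in (0 : ℝ)..1, G x t) '' d) (∫ t in (0 : ℝ)..1, g t) := by
  have hg : Antitone g := fun s t hst => (hl t).2 (by
    rintro _ ⟨x, hx, rfl⟩
    exact (hG x hst).trans ((hl s).1 ⟨x, hx, rfl⟩))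
  have scale : ∀ (N : ℕ), 0 < N → ∀ h : ℝ → ℝ,
      ∫ t in (0 : ℝ)..1, h t = (N : ℝ)⁻¹ * ∫ t in (0 : ℝ)..0 + N, h (t / N) := by
    intro N hN h
    have hN' : (N : ℝ) ≠ 0 := by positivity
    rw [intervalIntegral.integral_comp_div _ hN']
    simp [hN']
  refine ⟨?_, fun c hc => ?_⟩
  · rintro _ ⟨x, hx, rfl⟩
    exact intervalIntegral.integral_mono zero_le_one (hG x).intervalIntegrable
      hg.intervalIntegrable fun t => (hl t).1 ⟨x, hx, rfl⟩
  · have key : ∀ N : ℕ, 0 < N → ∫ t in (0 : ℝ)..1, g t ≤ c + (N : ℝ)⁻¹ * (g 0 - g 1) := by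
      intro N hN
      have hNn : (0 : ℝ) ≤ (N : ℝ)⁻¹ := by positivity
      have hN' : (N : ℝ) ≠ 0 := by positivity
      have hdiv : ∀ h : ℝ → ℝ, Antitone h → Antitone fun t => h (t / N) := fun h hh s t hst =>
        hh (by gcongr)
      have h1 : ∫ t in (0 : ℝ)..1, g t ≤ (N : ℝ)⁻¹ * ∑ i ∈ Finset.range N, g (i / N) := by
        rw [scale N hN]
        refine mul_le_mul_of_nonneg_left ?_ hNn
        simpa using ((hdiv g hg).antitoneOn (Icc (0 : ℝ) (0 + N))).integral_le_sum
      have h2 : (N : ℝ)⁻¹ * ∑ i ∈ Finset.range N, g ((i + 1 : ℕ) / N) ≤ c := by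
        have hL := isLUB_const_mul h0 hNn (isLUB_sum h0 hd (Finset.range N)
          (f := fun (i : ℕ) x => G x ((i + 1 : ℕ) / N)) (fun i => hm _) (fun i => hl _))
        refine hL.2 ?_
        rintro _ ⟨x, hx, rfl⟩
        refine le_trans ?_ (hc ⟨x, hx, rfl⟩)
        simp only
        rw [scale N hN]
        refine mul_le_mul_of_nonneg_left ?_ hNn
        simpa using ((hdiv (G x) (hG x)).antitoneOn (Icc (0 : ℝ) (0 + N))).sum_le_integral
      have h3 : ∑ i ∈ Finset.range N, g (i / N)
          = ∑ i ∈ Finset.range N, g ((i + 1 : ℕ) / N) + (g 0 - g 1) := by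
        have := Finset.sum_range_sub (fun i : ℕ => g (i / N)) N
        rw [Finset.sum_sub_distrib] at this
        simp only [div_self hN', Nat.cast_zero, zero_div] at this
        linarith
      rw [h3, mul_add] at h1
      linarith
    have hlim : Filter.Tendsto (fun N : ℕ => c + (N : ℝ)⁻¹ * (g 0 - g 1)) Filter.atTop
        (nhds (c + 0 * (g 0 - g 1))) :=
      tendsto_const_nhds.add ((tendsto_inv_atTop_nhds_zero_nat (𝕜 := ℝ)).mul_const _)
    rw [zero_mul, add_zero] at hlim
    exact ge_of_tendsto hlim (Filter.eventually_atTop.2 ⟨1, fun N hN => key N hN⟩)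

/-! ### Subprobability valuations -/

/-- A subprobability valuation on a topological space: a strict, modular, Scott-continuous
function from the complete lattice of open sets to `[0,1]`. -/
@[ext]
structure SubprobVal (X : Type*) [TopologicalSpace X] where
  toFun : Opens X → I
  scottContinuous : ScottContinuous toFun
  strict : toFun ⊥ = 0
  modular : ∀ U V, (toFun U : ℝ) + toFun V = toFun (U ⊔ V) + toFun (U ⊓ V)

namespace SubprobVal

section Basic

variable {X : Type*} [TopologicalSpace X]

/-- The stochastic order. -/
instance : PartialOrder (SubprobVal X) where
  le ν ξ := ∀ U, ν.toFun U ≤ ξ.toFun U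
  le_refl ν U := le_rfl
  le_trans ν ξ ζ h h' U := (h U).trans (h' U)
  le_antisymm ν ξ h h' := SubprobVal.ext (funext fun U => le_antisymm (h U) (h' U))

lemma toFun_mono (ν : SubprobVal X) {U V : Opens X} (h : U ≤ V) :
    (ν.toFun U : ℝ) ≤ ν.toFun V := ν.scottContinuous.monotone h

lemma eval_mono (U : Opens X) : Monotone fun ν : SubprobVal X => (ν.toFun U : ℝ) :=
  fun _ _ h => h U

lemma isLUB_of_pointwise {d : Set (SubprobVal X)} (h0 : d.Nonempty) {ν : SubprobVal X}
    (h : ∀ U, IsLUB ((fun ξ : SubprobVal X => (ξ.toFun U : ℝ)) '' d) (ν.toFun U)) :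
    IsLUB d ν := by
  have h' := fun U => (isLUB_coe_image h0).1 (h U)
  exact ⟨fun ξ hξ U => (h' U).1 (mem_image_of_mem (fun ξ : SubprobVal X => ξ.toFun U) hξ),
    fun ζ hζ U => (h' U).2 (by rintro _ ⟨ξ, hξ, rfl⟩; exact hζ hξ U)⟩

/-- The pointwise supremum of a directed family of valuations. -/
def dirSup (d : Set (SubprobVal X)) (h0 : d.Nonempty) (hd : DirectedOn (· ≤ ·) d) :
    SubprobVal X where
  toFun U := sSup ((fun ξ : SubprobVal X => ξ.toFun U) '' d)
  scottContinuous := by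
    intro e he0 hed W hW
    refine ⟨?_, fun c hc => sSup_le ?_⟩
    · rintro _ ⟨U, hU, rfl⟩
      refine sSup_le ?_
      rintro _ ⟨ξ, hξ, rfl⟩
      exact (ξ.scottContinuous.monotone (hW.1 hU)).trans (le_sSup ⟨ξ, hξ, rfl⟩)
    · rintro _ ⟨ξ, hξ, rfl⟩
      refine (ξ.scottContinuous he0 hed hW).2 ?_
      rintro _ ⟨U, hU, rfl⟩
      refine le_trans ?_ (hc ⟨U, hU, rfl⟩)
      exact le_sSup ⟨ξ, hξ, rfl⟩
  strict := by
    refine le_antisymm (sSup_le ?_) bot_le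
    rintro _ ⟨ξ, hξ, rfl⟩
    exact ξ.strict.le
  modular := by
    intro U V
    have h : ∀ U, IsLUB ((fun ξ : SubprobVal X => (ξ.toFun U : ℝ)) '' d)
        ((sSup ((fun ξ : SubprobVal X => ξ.toFun U) '' d) : I) : ℝ) := fun U =>
      (isLUB_coe_image h0).2 (isLUB_sSup _)
    have h1 := isLUB_add hd (eval_mono U) (eval_mono V) (h U) (h V)
    have h2 := isLUB_add hd (eval_mono (U ⊔ V)) (eval_mono (U ⊓ V)) (h (U ⊔ V)) (h (U ⊓ V))
    refine h1.unique ?_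
    rw [show (fun ξ : SubprobVal X => (ξ.toFun U : ℝ) + ξ.toFun V) = fun ξ : SubprobVal X =>
      (ξ.toFun (U ⊔ V) : ℝ) + ξ.toFun (U ⊓ V) from funext fun ξ => ξ.modular U V]
    exact h2

lemma dirSup_pointwise {d : Set (SubprobVal X)} (h0 : d.Nonempty) (hd : DirectedOn (· ≤ ·) d)
    (U : Opens X) :
    IsLUB ((fun ξ : SubprobVal X => (ξ.toFun U : ℝ)) '' d) ((dirSup d h0 hd).toFun U) :=
  (isLUB_coe_image h0).2 (isLUB_sSup _)

lemma isLUB_pointwise {d : Set (SubprobVal X)} (h0 : d.Nonempty) (hd : DirectedOn (· ≤ ·) d)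
    {ν : SubprobVal X} (h : IsLUB d ν) (U : Opens X) :
    IsLUB ((fun ξ : SubprobVal X => (ξ.toFun U : ℝ)) '' d) (ν.toFun U) := by
  rw [h.unique (isLUB_of_pointwise h0 (dirSup_pointwise h0 hd))]
  exact dirSup_pointwise h0 hd U

/-- The Dirac valuation. -/
def dirac (x : X) : SubprobVal X where
  toFun U := open Classical in if x ∈ U then 1 else 0
  scottContinuous := by
    classical
    intro d h0 hd W hW
    have hWs : W = sSup d := hW.unique (isLUB_sSup d)
    refine ⟨?_, fun c hc => ?_⟩
    · rintro _ ⟨U, hU, rfl⟩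
      by_cases hx : x ∈ U
      · simp [hx, hW.1 hU hx]
      · simp [hx]
    · by_cases hx : x ∈ W
      · have hx' := hx
        rw [hWs, Opens.mem_sSup] at hx'
        obtain ⟨U, hU, hxU⟩ := hx'
        have := hc ⟨U, hU, rfl⟩
        simpa [hx, hxU] using this
      · simp [hx]
  strict := by
    classical
    exact if_neg (by simp)
  modular := by
    classical
    intro U V
    by_cases h1 : x ∈ U <;> by_cases h2 : x ∈ V <;>
      simp [h1, h2]

lemma dirac_apply (x : X) (U : Opens X) :
    ((dirac x).toFun U : ℝ) = open Classical in if x ∈ U then 1 else 0 := by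
  classical
  simp only [dirac]
  split_ifs <;> simp

lemma weighted_mem {ι : Type*} [Fintype ι] (r : ι → I) (hr : ∑ i, (r i : ℝ) ≤ 1) (f : ι → I) :
    ∑ i, (r i : ℝ) * f i ∈ I :=
  ⟨Finset.sum_nonneg fun i _ => mul_nonneg (r i).2.1 (f i).2.1,
    (Finset.sum_le_sum fun i _ => mul_le_of_le_one_right (r i).2.1 (f i).2.2).trans hr⟩

/-- The convex sum `∑ r_i ν_i` of valuations, for `∑ r_i ≤ 1`. -/
def combo {ι : Type*} [Fintype ι] (r : ι → I) (hr : ∑ i, (r i : ℝ) ≤ 1)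
    (ν : ι → SubprobVal X) : SubprobVal X where
  toFun U := ⟨∑ i, (r i : ℝ) * (ν i).toFun U, weighted_mem r hr _⟩
  scottContinuous := by
    rw [← scottContinuous_coe]
    intro d h0 hd W hW
    exact isLUB_sum h0 hd _ (f := fun i U => (r i : ℝ) * (ν i).toFun U)
      (fun i U V h => mul_le_mul_of_nonneg_left ((ν i).toFun_mono h) (r i).2.1) fun i => isLUB_const_mul (r := (r i : ℝ)) h0 (r i).2.1
        (scottContinuous_coe.2 (ν i).scottContinuous h0 hd hW)
  strict := by ext; simp [(ν _).strict]
  modular := by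
    intro U V
    simp only [← Finset.sum_add_distrib, ← mul_add]
    exact Finset.sum_congr rfl fun i _ => by rw [(ν i).modular U V]

@[simp] lemma combo_apply {ι : Type*} [Fintype ι] (r : ι → I) (hr : ∑ i, (r i : ℝ) ≤ 1)
    (ν : ι → SubprobVal X) (U : Opens X) :
    ((combo r hr ν).toFun U : ℝ) = ∑ i, (r i : ℝ) * (ν i).toFun U := rfl

/-- The simple valuation `∑ r_i δ_{x_i}`. -/
def simpleVal {n : ℕ} (r : Fin n → I) (hr : ∑ i, (r i : ℝ) ≤ 1) (x : Fin n → X) : SubprobVal X :=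
  combo r hr fun i => dirac (x i)

/-- Simple valuations. Terms of weight zero are harmless; the empty sum is the zero valuation. -/
def IsSimple (ν : SubprobVal X) : Prop :=
  ∃ (n : ℕ) (r : Fin n → I) (hr : ∑ i, (r i : ℝ) ≤ 1) (x : Fin n → X), ν = simpleVal r hr x

lemma isSimple_combo_dirac {ι : Type*} [Fintype ι] (r : ι → I) (hr : ∑ i, (r i : ℝ) ≤ 1)
    (x : ι → X) : IsSimple (combo r hr fun i => dirac (x i)) := by
  let e := (Fintype.equivFin ι).symm
  refine ⟨Fintype.card ι, r ∘ e, ?_, x ∘ e, ?_⟩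
  · exact (Equiv.sum_comp e fun i => (r i : ℝ)).trans_le hr
  · refine SubprobVal.ext (funext fun U => Subtype.ext ?_)
    exact (Equiv.sum_comp e fun i => (r i : ℝ) * (dirac (x i)).toFun U).symm

/-- The integral `∫ f dν = ∫_0^1 ν(f⁻¹((t,1])) dt`, for `f` continuous to `[0,1]` with the Scott
topology, that is, lower semicontinuous. -/
def integral (ν : SubprobVal X) (f : X → I) (hf : LowerSemicontinuous fun x => (f x : ℝ)) : ℝ :=
  ∫ t in (0 : ℝ)..1, (ν.toFun ⟨{x | t < (f x : ℝ)}, hf.isOpen_preimage t⟩ : ℝ)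

lemma level_antitone (f : X → I) (hf : LowerSemicontinuous fun x => (f x : ℝ)) :
    Antitone fun t : ℝ => (⟨{x | t < (f x : ℝ)}, hf.isOpen_preimage t⟩ : Opens X) :=
  fun _ _ h _ hx => lt_of_le_of_lt h hx

lemma integrand_antitone (ν : SubprobVal X) (f : X → I)
    (hf : LowerSemicontinuous fun x => (f x : ℝ)) :
    Antitone fun t : ℝ => (ν.toFun ⟨{x | t < (f x : ℝ)}, hf.isOpen_preimage t⟩ : ℝ) :=
  fun _ _ h => ν.toFun_mono (level_antitone f hf h)

lemma integral_mem (ν : SubprobVal X) (f : X → I) (hf : LowerSemicontinuous fun x => (f x : ℝ)) :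
    ν.integral f hf ∈ I := by
  constructor
  · exact intervalIntegral.integral_nonneg zero_le_one fun t _ => (ν.toFun _).2.1
  · have := intervalIntegral.integral_mono (μ := MeasureTheory.volume) zero_le_one
      (integrand_antitone ν f hf).intervalIntegrable
      (intervalIntegrable_const (c := (1 : ℝ))) fun t => (ν.toFun _).2.2
    simpa [integral] using this

lemma integral_isLUB {d : Set (SubprobVal X)} (h0 : d.Nonempty) (hd : DirectedOn (· ≤ ·) d)
    {ν : SubprobVal X} (h : IsLUB d ν) (f : X → I)
    (hf : LowerSemicontinuous fun x => (f x : ℝ)) :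
    IsLUB ((fun ξ : SubprobVal X => ξ.integral f hf) '' d) (ν.integral f hf) :=
  isLUB_integral h0 hd (fun ξ => integrand_antitone ξ f hf) (fun _ => eval_mono _)
    fun _ => isLUB_pointwise h0 hd h _

lemma integral_combo {ι : Type*} [Fintype ι] (r : ι → I) (hr : ∑ i, (r i : ℝ) ≤ 1)
    (ν : ι → SubprobVal X) (f : X → I) (hf : LowerSemicontinuous fun x => (f x : ℝ)) :
    (combo r hr ν).integral f hf = ∑ i, (r i : ℝ) * (ν i).integral f hf := by
  simp only [integral, combo_apply]
  rw [intervalIntegral.integral_finsetSum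
    fun i _ => (integrand_antitone (ν i) f hf).intervalIntegrable.const_mul _]
  simp only [intervalIntegral.integral_const_mul]

lemma integral_indicator (c : I) :
    ∫ t in (0 : ℝ)..1, (open Classical in if t < (c : ℝ) then (1 : ℝ) else 0) = c := by
  classical
  have h1 : ∀ a b : ℝ, IntervalIntegrable
      (fun t : ℝ => if t < (c : ℝ) then (1 : ℝ) else 0) MeasureTheory.volume a b := by
    intro a b
    refine Antitone.intervalIntegrable fun s t hst => ?_
    by_cases h : t < (c : ℝ)
    · simp [h, lt_of_le_of_lt hst h]
    · simp only [h, if_false]; split_ifs <;> norm_num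
  rw [← intervalIntegral.integral_add_adjacent_intervals (h1 0 c) (h1 c 1)]
  have e1 : ∫ t in (0 : ℝ)..c, (if t < (c : ℝ) then (1 : ℝ) else 0) = c := by
    rw [intervalIntegral.integral_congr_Ioo_of_le (g := fun _ => (1 : ℝ)) c.2.1]
    · simp
    · intro t ht
      simp [ht.2]
  have e2 : ∫ t in (c : ℝ)..1, (if t < (c : ℝ) then (1 : ℝ) else 0) = 0 := by
    rw [intervalIntegral.integral_congr (g := fun _ => (0 : ℝ))]
    · simp
    · intro t ht
      rw [uIcc_of_le c.2.2] at ht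
      simp [not_lt.2 ht.1]
  rw [e1, e2, add_zero]

lemma integral_dirac (x : X) (f : X → I) (hf : LowerSemicontinuous fun x => (f x : ℝ)) :
    (dirac x).integral f hf = f x := by
  simp only [integral, dirac_apply]
  exact integral_indicator (f x)

/-- The integral of the characteristic function of an open set. -/
lemma integral_char (ν : SubprobVal X) (U : Opens X) (f : X → I)
    (hf : LowerSemicontinuous fun x => (f x : ℝ))
    (hfU : ∀ x, (f x : ℝ) = open Classical in if x ∈ U then 1 else 0) :
    ν.integral f hf = ν.toFun U := by
  classical
  have : ∀ t ∈ Ico (0 : ℝ) 1,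
      (⟨{x | t < (f x : ℝ)}, hf.isOpen_preimage t⟩ : Opens X) = U := by
    intro t ht
    ext x
    simp only [hfU]
    by_cases hx : x ∈ U <;> simp [hx, ht.1, ht.2]
  unfold integral
  rw [intervalIntegral.integral_congr_Ioo_of_le (g := fun _ => (ν.toFun U : ℝ)) zero_le_one]
  · simp
  · intro t ht
    simp only [this t ⟨ht.1.le, ht.2⟩]

/-- The image valuation `U ↦ ν(f⁻¹(U))`. -/
def map {Y : Type*} [TopologicalSpace Y] (f : C(X, Y)) (ν : SubprobVal X) : SubprobVal Y where
  toFun U := ν.toFun (U.comap f)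
  scottContinuous := by
    intro d h0 hd W hW
    have hWs : W = sSup d := hW.unique (isLUB_sSup d)
    have h := ν.scottContinuous (h0.image (Opens.comap f))
      (directedOn_image.2 (hd.mono fun {_ _} h => Opens.comap_mono f h))
      (a := Opens.comap f W) ?_
    · rwa [image_image] at h
    · rw [hWs, map_sSup]
      exact isLUB_sSup _
  strict := by
    rw [← ν.strict]; congr 1
  modular := by
    intro U V
    exact ν.modular (U.comap f) (V.comap f)

end Basic

end SubprobVal

open SubprobVal

/-! ### The dcpo `M D` -/

section Scott

variable {D : Type u} [PartialOrder D] {E : Type u} [PartialOrder E]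

/-- A Scott-continuous map as a continuous map for the Scott topologies. -/
def scottMap (f : D → E) (hf : ScottContinuous f) : C(WithScott D, WithScott E) where
  toFun x := WithScott.toScott (f (WithScott.ofScott x))
  continuous_toFun := (IsScott.scottContinuousOn_iff_continuous (D := univ)
    (fun _ _ _ => trivial)).1 (scottContinuousOn_univ.2 hf)

lemma lsc_of_scottContinuous {f : D → I} (hf : ScottContinuous f) :
    LowerSemicontinuous fun x : WithScott D => (f (WithScott.ofScott x) : ℝ) := by
  rw [lowerSemicontinuous_iff_isOpen_preimage]
  intro t
  rw [IsScott.isOpen_iff_isUpperSet_and_dirSupInaccOn (D := univ)]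
  refine ⟨fun x y hxy hx => lt_of_lt_of_le (b := (f (WithScott.ofScott x) : ℝ)) hx
    (hf.monotone hxy), fun d _ h0 hd a ha hat => ?_⟩
  by_contra hcon
  have h := (isLUB_coe_image h0).2 (hf h0 hd ha)
  refine not_le.2 hat (h.2 ?_)
  rintro _ ⟨x, hx, rfl⟩
  by_contra hx'
  exact hcon ⟨x, hx, not_le.1 hx'⟩

lemma exists_mem_of_isLUB {d : Set D} (h0 : d.Nonempty) (hd : DirectedOn (· ≤ ·) d) {a : D}
    (ha : IsLUB d a) (U : Opens (WithScott D)) (haU : WithScott.toScott a ∈ U) :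
    ∃ x ∈ d, WithScott.toScott x ∈ U := by
  have hU := (IsScott.isOpen_iff_isUpperSet_and_dirSupInaccOn (α := WithScott D)
    (D := univ)).1 U.isOpen
  obtain ⟨x, hx, hxU⟩ := hU.2 trivial h0 hd ha haU
  exact ⟨x, hx, hxU⟩

end Scott

section M

/-- The underlying set of `M D`: the intersection of all sub-dcpos of `V D` (sets of valuations
closed under directed suprema) that contain the simple valuations. -/
def MSet (D : Type u) [PartialOrder D] : Set (SubprobVal (WithScott D)) :=
  ⋂₀ {B | DirSupClosed B ∧ ∀ s, IsSimple s → s ∈ B}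

/-- `M D`, with the stochastic order. -/
abbrev MVal (D : Type u) [PartialOrder D] : Type u := {ν : SubprobVal (WithScott D) // ν ∈ MSet D}

variable {D : Type u} [PartialOrder D] {E : Type u} [PartialOrder E]

lemma simple_mem {s : SubprobVal (WithScott D)} (hs : IsSimple s) : s ∈ MSet D :=
  fun _ hB => hB.2 s hs

lemma MSet_closed : DirSupClosed (MSet D) := fun _ hd h0 hdir _ ha B hB =>
  hB.1 (fun _ hx => hd hx B hB) h0 hdir ha

lemma MSet_induction {P : SubprobVal (WithScott D) → Prop} (hs : ∀ s, IsSimple s → P s)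
    (hd : ∀ d ⊆ MSet D, d.Nonempty → DirectedOn (· ≤ ·) d → (∀ ξ ∈ d, P ξ) →
      ∀ ν, IsLUB d ν → P ν) {ν : SubprobVal (WithScott D)} (hν : ν ∈ MSet D) : P ν := by
  have h := hν {ξ | ξ ∈ MSet D ∧ P ξ} ⟨fun d hdB h0 hdir a ha =>
    ⟨MSet_closed (fun x hx => (hdB hx).1) h0 hdir ha,
      hd d (fun x hx => (hdB hx).1) h0 hdir (fun x hx => (hdB hx).2) a ha⟩,
    fun s h => ⟨simple_mem h, hs s h⟩⟩
  exact h.2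

lemma MVal.isLUB_val {d : Set (MVal D)} (h0 : d.Nonempty) (hd : DirectedOn (· ≤ ·) d)
    {ν : MVal D} (h : IsLUB d ν) : IsLUB (Subtype.val '' d) ν.1 := by
  have hd' : DirectedOn (· ≤ ·) (Subtype.val '' d) := directedOn_image.2 hd
  have hL := isLUB_of_pointwise (h0.image _) (dirSup_pointwise (h0.image Subtype.val) hd')
  have hm : dirSup _ (h0.image Subtype.val) hd' ∈ MSet D :=
    MSet_closed (by rintro _ ⟨x, _, rfl⟩; exact x.2) (h0.image _) hd' hL
  have hL' : IsLUB d (⟨_, hm⟩ : MVal D) := ⟨fun x hx => hL.1 ⟨x, hx, rfl⟩,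
    fun c hc => hL.2 (by rintro _ ⟨x, hx, rfl⟩; exact hc hx)⟩
  rw [h.unique hL']
  exact hL

instance : IsDcpo (MVal D) where
  exists_isLUB d h0 hd := by
    have hd' : DirectedOn (· ≤ ·) (Subtype.val '' d) := directedOn_image.2 hd
    have hL := isLUB_of_pointwise (h0.image _) (dirSup_pointwise (h0.image Subtype.val) hd')
    have hm : dirSup _ (h0.image Subtype.val) hd' ∈ MSet D :=
      MSet_closed (by rintro _ ⟨x, _, rfl⟩; exact x.2) (h0.image _) hd' hL
    exact ⟨⟨_, hm⟩, fun x hx => hL.1 ⟨x, hx, rfl⟩,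
      fun c hc => hL.2 (by rintro _ ⟨x, hx, rfl⟩; exact hc hx)⟩

lemma MVal.isLUB_pointwise {d : Set (MVal D)} (h0 : d.Nonempty) (hd : DirectedOn (· ≤ ·) d)
    {ν : MVal D} (h : IsLUB d ν) (U : Opens (WithScott D)) :
    IsLUB ((fun ξ : MVal D => (ξ.1.toFun U : ℝ)) '' d) (ν.1.toFun U) := by
  have := SubprobVal.isLUB_pointwise (h0.image _) (directedOn_image.2 hd)
    (MVal.isLUB_val h0 hd h) U
  rwa [image_image] at this

/-- Maps into `M E` are Scott-continuous if they are pointwise so. -/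
lemma MVal.scottContinuous_of_pointwise {f : D → MVal E}
    (h : ∀ U, ScottContinuous fun x => ((f x).1.toFun U : ℝ)) : ScottContinuous f := by
  intro d h0 hd a ha
  have h1 : IsLUB ((fun x => (f x).1) '' d) (f a).1 := by
    refine isLUB_of_pointwise (h0.image _) fun U => ?_
    rw [image_image]
    exact h U h0 hd ha
  exact ⟨by rintro _ ⟨x, hx, rfl⟩; exact h1.1 ⟨x, hx, rfl⟩,
    fun c hc => h1.2 (by rintro _ ⟨x, hx, rfl⟩; exact hc ⟨x, hx, rfl⟩)⟩

lemma MVal.ext' {ν ξ : MVal D} (h : ∀ U, (ν.1.toFun U : ℝ) = ξ.1.toFun U) : ν = ξ :=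
  Subtype.ext (SubprobVal.ext (funext fun U => Subtype.ext (h U)))

lemma MVal.eval_scottContinuous (U : Opens (WithScott D)) :
    ScottContinuous fun ν : MVal D => ν.1.toFun U :=
  scottContinuous_coe.1 fun _ h0 hd _ h => MVal.isLUB_pointwise h0 hd h U

/-- `M D` is closed under convex sums. -/
lemma combo_mem {ι : Type} [Fintype ι] (r : ι → I) (hr : ∑ i, (r i : ℝ) ≤ 1)
    (ν : ι → SubprobVal (WithScott D)) (hν : ∀ i, ν i ∈ MSet D) : combo r hr ν ∈ MSet D := by
  classical
  suffices H : ∀ (s : Finset ι) (ν : ι → SubprobVal (WithScott D)), (∀ i ∈ s, ν i ∈ MSet D) →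
      (∀ i ∉ s, IsSimple (ν i)) → combo r hr ν ∈ MSet D from
    H Finset.univ ν (fun i _ => hν i) fun i hi => absurd (Finset.mem_univ i) hi
  clear hν ν
  intro s
  induction s using Finset.induction_on with
  | empty =>
    intro ν _ hν
    choose n w hw x hx using fun i => hν i (Finset.notMem_empty i)
    have hsum : ∑ k : (i : ι) × Fin (n i), ((r k.1 * w k.1 k.2 : I) : ℝ) ≤ 1 := by
      rw [Fintype.sum_sigma]
      refine le_trans (Finset.sum_le_sum fun i _ => ?_) hr
      simp only [Icc.coe_mul, ← Finset.mul_sum]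
      exact mul_le_of_le_one_right (r i).2.1 (hw i)
    have hs := isSimple_combo_dirac (fun k : (i : ι) × Fin (n i) => r k.1 * w k.1 k.2) hsum
      fun k => x k.1 k.2
    convert simple_mem hs using 1
    refine SubprobVal.ext (funext fun U => Subtype.ext ?_)
    rw [combo_apply, combo_apply, Fintype.sum_sigma]
    refine Finset.sum_congr rfl fun i _ => ?_
    rw [hx i, simpleVal, combo_apply, Finset.mul_sum]
    exact Finset.sum_congr rfl fun j _ => by simp [mul_assoc]
  | insert j s hj ih =>
    intro ν hν hν'
    have key : ∀ ξ ∈ MSet D, combo r hr (Function.update ν j ξ) ∈ MSet D := by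
      intro ξ hξ
      refine MSet_induction (P := fun ξ => combo r hr (Function.update ν j ξ) ∈ MSet D)
        (fun t ht => ih _ (fun i hi => ?_) fun i hi => ?_) (fun d _ h0 hd hP a ha => ?_) hξ
      · have hij : i ≠ j := fun h => hj (h ▸ hi)
        rw [Function.update_of_ne hij]
        exact hν i (Finset.mem_insert_of_mem hi)
      · by_cases hij : i = j
        · subst hij; rwa [Function.update_self]
        · rw [Function.update_of_ne hij]
          exact hν' i (by simp [hij, hi])
      · have hm : ∀ i U, Monotone fun ξ : SubprobVal (WithScott D) =>
            (r i : ℝ) * (Function.update ν j ξ i).toFun U := by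
          intro i U ξ ζ h
          refine mul_le_mul_of_nonneg_left ?_ (r i).2.1
          by_cases hij : i = j
          · subst hij; simpa using h U
          · simp [Function.update_of_ne hij]
        refine MSet_closed (d := (fun ξ => combo r hr (Function.update ν j ξ)) '' d)
          (by rintro _ ⟨ξ, hξ, rfl⟩; exact hP ξ hξ) (h0.image _)
          (directedOn_image.2 (hd.mono fun {ξ ζ} h U => Finset.sum_le_sum fun i _ => hm i U h))
          (isLUB_of_pointwise (h0.image _) fun U => ?_)
        rw [image_image]
        refine isLUB_sum h0 hd Finset.univ (fun i => hm i U) fun i => ?_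
        refine isLUB_const_mul (r := (r i : ℝ))
          (f := fun ξ => ((Function.update ν j ξ i).toFun U : ℝ)) h0 (r i).2.1 ?_
        by_cases hij : i = j
        · subst hij
          simpa using SubprobVal.isLUB_pointwise h0 hd ha U
        · simpa [Function.update_of_ne hij] using isLUB_const h0 _
    have := key (ν j) (hν j (Finset.mem_insert_self j s))
    rwa [Function.update_eq_self] at this

/-- The constantly zero valuation. -/
def zeroVal (X : Type*) [TopologicalSpace X] : SubprobVal X where
  toFun _ := 0
  scottContinuous := ScottContinuous.const 0
  strict := rfl
  modular _ _ := rfl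

lemma zeroVal_mem : zeroVal (WithScott D) ∈ MSet D :=
  simple_mem ⟨0, Fin.elim0, by simp, Fin.elim0, by
    refine SubprobVal.ext (funext fun U => Subtype.ext ?_)
    simp [simpleVal, zeroVal]⟩

lemma two_weights (r : I) : ∑ i, ((![r, σ r] : Fin 2 → I) i : ℝ) ≤ 1 := by
  simp [Fin.sum_univ_two]

/-- `ν +_r ξ = r ν + (1 - r) ξ` in `M D`. -/
def MVal.mix (r : I) (ν ξ : MVal D) : MVal D :=
  ⟨combo ![r, σ r] (two_weights r) ![ν.1, ξ.1], combo_mem _ _ _ fun i => by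
    fin_cases i
    · exact ν.2
    · exact ξ.2⟩

lemma MVal.mix_apply (r : I) (ν ξ : MVal D) (U : Opens (WithScott D)) :
    ((MVal.mix r ν ξ).1.toFun U : ℝ) = r * ν.1.toFun U + (1 - r) * ξ.1.toFun U := by
  simp [MVal.mix, Fin.sum_univ_two]

/-- The convex structure of `M D`; the distinguished element is the zero valuation. -/
instance : PointedBarycentricAlgebra (MVal D) where
  mix := MVal.mix
  pt := ⟨zeroVal _, zeroVal_mem⟩
  mix_one ν ξ := MVal.ext' fun U => by simp [MVal.mix_apply]
  mix_symm r ν ξ := MVal.ext' fun U => by simp [MVal.mix_apply]; ring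
  mix_self r ν := MVal.ext' fun U => by simp [MVal.mix_apply]; ring
  mix_assoc r p q a b c hr hp hq := MVal.ext' fun U => by
    have h1 : (p : ℝ) * r < 1 :=
      lt_of_le_of_lt (mul_le_of_le_one_left r.2.1 p.2.2) hr
    have h2 : (q : ℝ) * (1 - p * r) = r - p * r := by
      rw [hq, div_mul_cancel₀]; linarith
    simp only [MVal.mix_apply, Icc.coe_mul]
    linear_combination ((c.1.toFun U : ℝ) - b.1.toFun U) * h2

/-- The simple valuation `∑ r_i δ_{x_i}` as an element of `M D`. -/
def MVal.simple {n : ℕ} (r : Fin n → I) (hr : ∑ i, (r i : ℝ) ≤ 1) (x : Fin n → D) : MVal D :=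
  ⟨simpleVal r hr fun i => WithScott.toScott (x i), simple_mem ⟨n, r, hr, _, rfl⟩⟩

/-! ### The structure maps of the monad -/

/-- The unit `x ↦ δ_x`. -/
def MVal.unit (x : D) : MVal D :=
  ⟨dirac (WithScott.toScott x), by
    convert simple_mem (isSimple_combo_dirac (fun _ : Fin 1 => (1 : I)) (by simp)
      fun _ => WithScott.toScott x) using 1
    refine SubprobVal.ext (funext fun U => Subtype.ext ?_)
    simp⟩

lemma MVal.unit_scottContinuous : ScottContinuous (MVal.unit : D → MVal D) := by
  classical
  refine MVal.scottContinuous_of_pointwise fun U d h0 hd a ha => ?_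
  have hup : ∀ x y : D, x ≤ y → WithScott.toScott x ∈ U → WithScott.toScott y ∈ U :=
    fun x y h hx => IsScott.isUpperSet_of_isOpen (α := WithScott D) (D := univ) U.isOpen h hx
  simp only [MVal.unit, dirac_apply]
  refine ⟨?_, fun c hc => ?_⟩
  · rintro _ ⟨x, hx, rfl⟩
    by_cases hxU : WithScott.toScott x ∈ U
    · simp [hxU, hup x a (ha.1 hx) hxU]
    · simp only [hxU, if_false]; split_ifs <;> norm_num
  · by_cases haU : WithScott.toScott a ∈ U
    · obtain ⟨x, hx, hxU⟩ := exists_mem_of_isLUB h0 hd ha U haU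
      have := hc ⟨x, hx, rfl⟩
      simpa [haU, hxU] using this
    · obtain ⟨x, hx⟩ := h0
      have hxU : WithScott.toScott x ∉ U := fun h => haU (hup x a (ha.1 hx) h)
      have := hc ⟨x, hx, rfl⟩
      simpa [haU, hxU] using this

lemma map_mem (f : D → E) (hf : ScottContinuous f) {ν : SubprobVal (WithScott D)}
    (hν : ν ∈ MSet D) : ν.map (scottMap f hf) ∈ MSet E := by
  refine MSet_induction (P := fun ν => ν.map (scottMap f hf) ∈ MSet E) ?_ ?_ hν
  · rintro _ ⟨n, r, hr, x, rfl⟩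
    exact simple_mem ⟨n, r, hr, fun i => scottMap f hf (x i), rfl⟩
  · intro d _ h0 hd hP a ha
    refine MSet_closed (d := SubprobVal.map (scottMap f hf) '' d)
      (by rintro _ ⟨ξ, hξ, rfl⟩; exact hP ξ hξ) (h0.image _)
      (directedOn_image.2 (hd.mono fun {ξ ζ} h U => h _))
      (isLUB_of_pointwise (h0.image _) fun U => ?_)
    rw [image_image]
    exact SubprobVal.isLUB_pointwise h0 hd ha _

/-- The action on Scott-continuous maps, `ν ↦ (U ↦ ν(f⁻¹(U)))`. -/
def MVal.map (f : D → E) (hf : ScottContinuous f) (ν : MVal D) : MVal E :=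
  ⟨ν.1.map (scottMap f hf), map_mem f hf ν.2⟩

lemma MVal.map_scottContinuous (f : D → E) (hf : ScottContinuous f) :
    ScottContinuous (MVal.map f hf) :=
  MVal.scottContinuous_of_pointwise fun _ _ h0 hd _ ha => MVal.isLUB_pointwise h0 hd ha _

lemma eval_lsc (U : Opens (WithScott D)) : LowerSemicontinuous
    fun ν : WithScott (MVal D) => ((WithScott.ofScott ν).1.toFun U : ℝ) :=
  lsc_of_scottContinuous (MVal.eval_scottContinuous U)

/-- `∫_{ν ∈ M D} ν(U) dϖ`. -/
def multInt (ϖ : SubprobVal (WithScott (MVal D))) (U : Opens (WithScott D)) : ℝ :=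
  ϖ.integral (fun ν => (WithScott.ofScott ν).1.toFun U) (eval_lsc U)

lemma multInt_simple {n : ℕ} (r : Fin n → I) (hr : ∑ i, (r i : ℝ) ≤ 1)
    (x : Fin n → WithScott (MVal D)) (U : Opens (WithScott D)) :
    multInt (simpleVal r hr x) U = ∑ i, (r i : ℝ) * (WithScott.ofScott (x i)).1.toFun U := by
  rw [multInt, simpleVal, integral_combo]
  simp only [integral_dirac]

lemma mult_exists {ϖ : SubprobVal (WithScott (MVal D))} (hϖ : ϖ ∈ MSet (MVal D)) :
    ∃ ξ ∈ MSet D, ∀ U, (ξ.toFun U : ℝ) = multInt ϖ U := by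
  refine MSet_induction (P := fun ϖ => ∃ ξ ∈ MSet D, ∀ U, (ξ.toFun U : ℝ) = multInt ϖ U)
    ?_ ?_ hϖ
  · rintro _ ⟨n, r, hr, x, rfl⟩
    refine ⟨combo r hr fun i => (WithScott.ofScott (x i)).1,
      combo_mem _ _ _ fun i => (WithScott.ofScott (x i)).2, fun U => ?_⟩
    exact (multInt_simple r hr x U).symm
  · intro d _ h0 hd hP a ha
    have : Nonempty (SubprobVal (WithScott D)) := ⟨zeroVal _⟩
    choose! F hF hFe using hP
    have hdir : DirectedOn (· ≤ ·) (F '' d) := by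
      rintro _ ⟨x, hx, rfl⟩ _ ⟨y, hy, rfl⟩
      obtain ⟨z, hz, hxz, hyz⟩ := hd x hx y hy
      have hmono : ∀ x ∈ d, x ≤ z → F x ≤ F z := by
        intro x hx hxz U
        have : (( F x).toFun U : ℝ) ≤ (F z).toFun U := by
          rw [hFe x hx, hFe z hz]
          exact intervalIntegral.integral_mono zero_le_one
            (integrand_antitone x _ (eval_lsc U)).intervalIntegrable
            (integrand_antitone z _ (eval_lsc U)).intervalIntegrable fun t => hxz _
        exact this
      exact ⟨F z, ⟨z, hz, rfl⟩, hmono x hx hxz, hmono y hy hyz⟩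
    have hL := dirSup_pointwise (h0.image F) hdir
    refine ⟨dirSup _ (h0.image F) hdir, MSet_closed
      (by rintro _ ⟨x, hx, rfl⟩; exact hF x hx) (h0.image F) hdir
      (isLUB_of_pointwise (h0.image F) hL), fun U => ?_⟩
    refine (hL U).unique ?_
    rw [image_image, image_congr fun x hx => hFe x hx U]
    exact integral_isLUB h0 hd ha _ _

/-- The multiplication `ϖ ↦ (U ↦ ∫_{ν ∈ M D} ν(U) dϖ)`. -/
def MVal.mult (ϖ : MVal (MVal D)) : MVal D :=
  have hfun : ∃ ξ ∈ MSet D, ξ.toFun = fun U => (⟨multInt ϖ.1 U, integral_mem _ _ _⟩ : I) := by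
    obtain ⟨ξ, hξ, h⟩ := mult_exists ϖ.2
    exact ⟨ξ, hξ, funext fun U => Subtype.ext (h U)⟩
  ⟨{ toFun := fun U => ⟨multInt ϖ.1 U, integral_mem _ _ _⟩
     scottContinuous := by
      obtain ⟨ξ, -, h⟩ := hfun
      rw [← h]; exact ξ.scottContinuous
     strict := by
      obtain ⟨ξ, -, h⟩ := hfun
      exact (congrFun h ⊥).symm.trans ξ.strict
     modular := by
      obtain ⟨ξ, -, h⟩ := hfun
      intro U V
      simpa only [h] using ξ.modular U V }, by
    obtain ⟨ξ, hξ, h⟩ := hfun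
    convert hξ using 1
    exact SubprobVal.ext h.symm⟩

lemma MVal.mult_apply (ϖ : MVal (MVal D)) (U : Opens (WithScott D)) :
    ((MVal.mult ϖ).1.toFun U : ℝ) = multInt ϖ.1 U := rfl

lemma MVal.integral_scottContinuous (f : WithScott D → I)
    (hf : LowerSemicontinuous fun x => (f x : ℝ)) :
    ScottContinuous fun ν : MVal D => ν.1.integral f hf := by
  intro d h0 hd a ha
  have := integral_isLUB (h0.image _) (directedOn_image.2 hd) (MVal.isLUB_val h0 hd ha) f hf
  rwa [image_image] at this

lemma MVal.mult_scottContinuous : ScottContinuous (MVal.mult : MVal (MVal D) → MVal D) :=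
  MVal.scottContinuous_of_pointwise fun U => MVal.integral_scottContinuous _ (eval_lsc U)

lemma integral_map {X Y : Type*} [TopologicalSpace X] [TopologicalSpace Y] (g : C(X, Y))
    (ν : SubprobVal X) (f : Y → I) (hf : LowerSemicontinuous fun x => (f x : ℝ))
    (hf' : LowerSemicontinuous fun x => (f (g x) : ℝ)) :
    (ν.map g).integral f hf = ν.integral (fun x => f (g x)) hf' := rfl

lemma MVal.intFun_lsc (f : WithScott D → I) (hf : LowerSemicontinuous fun x => (f x : ℝ)) :
    LowerSemicontinuous fun ν : WithScott (MVal D) =>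
      (((⟨(WithScott.ofScott ν).1.integral f hf, integral_mem _ _ _⟩ : I)) : ℝ) :=
  lsc_of_scottContinuous (f := fun ν : MVal D => (⟨ν.1.integral f hf, integral_mem _ _ _⟩ : I))
    (scottContinuous_coe.1 (MVal.integral_scottContinuous f hf))

/-- `∫ f d(μ ϖ) = ∫_ν (∫ f dν) dϖ`. -/
lemma MVal.integral_mult (ϖ : MVal (MVal D)) (f : WithScott D → I)
    (hf : LowerSemicontinuous fun x => (f x : ℝ)) :
    (MVal.mult ϖ).1.integral f hf = ϖ.1.integral
      (fun ν => ⟨(WithScott.ofScott ν).1.integral f hf, integral_mem _ _ _⟩)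
      (MVal.intFun_lsc f hf) := by
  obtain ⟨ϖ, hϖ⟩ := ϖ
  refine MSet_induction (P := fun ϖ => ∀ hϖ : ϖ ∈ MSet (MVal D),
    (MVal.mult ⟨ϖ, hϖ⟩).1.integral f hf = ϖ.integral
      (fun ν => ⟨(WithScott.ofScott ν).1.integral f hf, integral_mem _ _ _⟩)
      (MVal.intFun_lsc f hf)) ?_ ?_ hϖ hϖ
  · rintro _ ⟨n, r, hr, x, rfl⟩ hs
    have h1 : (MVal.mult ⟨_, hs⟩).1 = combo r hr fun i => (WithScott.ofScott (x i)).1 := by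
      refine SubprobVal.ext (funext fun U => Subtype.ext ?_)
      exact multInt_simple r hr x U
    have h2 : (simpleVal r hr x).integral
        (fun ν => ⟨(WithScott.ofScott ν).1.integral f hf, integral_mem _ _ _⟩)
        (MVal.intFun_lsc f hf) = ∑ i, (r i : ℝ) * (WithScott.ofScott (x i)).1.integral f hf := by
      rw [simpleVal, integral_combo]
      simp only [integral_dirac]
    rw [h1, integral_combo, h2]
  · intro d hdM h0 hd hP a ha haM
    let d' : Set (MVal (MVal D)) := {ξ | ξ.1 ∈ d}
    have h0' : d'.Nonempty := by
      obtain ⟨ξ, hξ⟩ := h0; exact ⟨⟨ξ, hdM hξ⟩, hξ⟩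
    have hd' : DirectedOn (· ≤ ·) d' := by
      intro x hx y hy
      obtain ⟨z, hz, h1, h2⟩ := hd x.1 hx y.1 hy
      exact ⟨⟨z, hdM hz⟩, hz, h1, h2⟩
    have ha' : IsLUB d' (⟨a, haM⟩ : MVal (MVal D)) :=
      ⟨fun ξ hξ => ha.1 hξ, fun c hc => ha.2 fun ξ hξ => hc (a := ⟨ξ, hdM hξ⟩) hξ⟩
    have h1 := (MVal.mult_scottContinuous.comp (MVal.integral_scottContinuous f hf)) h0' hd' ha'
    have h2 := MVal.integral_scottContinuous _ (MVal.intFun_lsc f hf) h0' hd' ha'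
    refine h1.unique ?_
    rw [image_congr fun ξ hξ => hP ξ.1 hξ ξ.2]
    exact h2

lemma MVal.map_id (ν : MVal D) : MVal.map (fun x => x) ScottContinuous.id ν = ν :=
  MVal.ext' fun _ => rfl

lemma MVal.map_unit (f : D → E) (hf : ScottContinuous f) (x : D) :
    MVal.map f hf (MVal.unit x) = MVal.unit (f x) :=
  MVal.ext' fun _ => rfl

lemma MVal.mult_unit (ν : MVal D) : MVal.mult (MVal.unit ν) = ν := MVal.ext' fun U => by
  rw [MVal.mult_apply, multInt, MVal.unit, integral_dirac]
  rfl

lemma MVal.mult_map_unit (ν : MVal D) :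
    MVal.mult (MVal.map MVal.unit MVal.unit_scottContinuous ν) = ν := MVal.ext' fun U => by
  rw [MVal.mult_apply, multInt]
  exact integral_char ν.1 U (fun x => (dirac x).toFun U)
    (lsc_of_scottContinuous (f := fun x : D => (MVal.unit x).1.toFun U)
      (MVal.unit_scottContinuous.comp (MVal.eval_scottContinuous U))) fun x => dirac_apply x U

lemma MVal.mult_map (f : D → E) (hf : ScottContinuous f) (ϖ : MVal (MVal D)) :
    MVal.mult (MVal.map (MVal.map f hf) (MVal.map_scottContinuous f hf) ϖ) =
      MVal.map f hf (MVal.mult ϖ) := MVal.ext' fun _ => rfl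

lemma MVal.mult_assoc (Ω : MVal (MVal (MVal D))) :
    MVal.mult (MVal.map MVal.mult MVal.mult_scottContinuous Ω) = MVal.mult (MVal.mult Ω) :=
  MVal.ext' fun U => (MVal.integral_mult Ω _ (eval_lsc U)).symm

end M

/-- The monad `M` on the category of dcpos. -/
def valuationMonad : Monad DCPO.{u} where
  obj D := ⟨MVal D.carrier⟩
  map f := ⟨MVal.map f.toFun f.scottContinuous, MVal.map_scottContinuous _ _⟩
  map_id _ := DCPO.Hom.ext (funext fun ν => MVal.map_id ν)
  map_comp _ _ := DCPO.Hom.ext (funext fun _ => MVal.ext' fun _ => rfl)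
  η :=
    { app := fun _ => ⟨MVal.unit, MVal.unit_scottContinuous⟩
      naturality := fun _ _ f => DCPO.Hom.ext (funext fun x =>
        (MVal.map_unit f.toFun f.scottContinuous x).symm) }
  μ :=
    { app := fun _ => ⟨MVal.mult, MVal.mult_scottContinuous⟩
      naturality := fun _ _ f => DCPO.Hom.ext (funext fun ϖ =>
        MVal.mult_map f.toFun f.scottContinuous ϖ) }
  assoc _ := DCPO.Hom.ext (funext fun Ω => MVal.mult_assoc Ω)
  left_unit _ := DCPO.Hom.ext (funext fun ν => MVal.mult_unit ν)
  right_unit _ := DCPO.Hom.ext (funext fun ν => MVal.mult_map_unit ν)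

/-- `(X, a)` is an Eilenberg-Moore algebra of the monad `T`: the unit and the associativity law
of `CategoryTheory.Monad.Algebra`. -/
def IsEilenbergMooreAlgebra {C : Type*} [Category C] (T : Monad C) (X : C) (a : T.obj X ⟶ X) :
    Prop :=
  T.η.app X ≫ a = 𝟙 X ∧ T.μ.app X ≫ a = T.map a ≫ a

/-! ### Barycenters -/

section Barycenter

variable {K : Type u} [PartialOrder K] [PointedBarycentricAlgebra K]

/-- `s` is a simple valuation `∑ r_i δ_{x_i}` and `b` is its finite barycenter `∑ r_i x_i`. -/
def IsFiniteBarycenter (s : MVal K) (b : K) : Prop :=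
  ∃ (n : ℕ) (r : Fin n → I) (hr : ∑ i, (r i : ℝ) ≤ 1) (x : Fin n → K),
    s = MVal.simple r hr x ∧ b = convexSum r x

/-- `β` is the barycenter map: `β ν` is the supremum of the finite barycenters of the simple
valuations way-below `ν` in `M K`. -/
def IsBarycenterMap (β : MVal K → K) : Prop :=
  ∀ ν, IsLUB {b | ∃ s, WayBelow s ν ∧ IsFiniteBarycenter s b} (β ν)

end Barycenter

end

end Kegel

open Kegel

namespace Kegel

noncomputable section

open PointedBarycentricAlgebra SubprobVal

/-! ### The way-below relation -/

section WayBelow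

variable {D : Type*} [PartialOrder D]

/-! The barycenter of a simple valuation `∑ r_i δ_{x_i}` has to be `∑ r_i x_i`. If this depends
monotonically on the valuation, and if the simple valuations form a basis of `M K`, then the suprema
in the statement are directed and define a Scott-continuous map. Every point of `M K` is reached
from simple valuations by directed suprema, so linearity and the associativity law, being equations
between Scott-continuous maps, need only be checked on simple valuations, where they are identities
between convex sums.

Monotonicity (`IsFiniteBarycenter.mono`) is the main difficulty. `K` embeds into an ordered
commutative monoid, the cone of formal multiples `r · x`, in which a convex sum is an honest sum.
The embedding reflects the order because multiplication by a positive scalar does so in a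
Kegelspitze (`le_of_rsmul_le_rsmul`). Suppose `∑ r_i δ_{x_i} ≤ ∑ s_j δ_{y_j}`. Evaluating both sides
on suitable open sets gives Hall's condition for the relation `x_i ≤ y_j`. For `q < 1`, the masses
`q r_i`, rounded up, and `s_j`, rounded down, are cut into equal units, and Hall's marriage theorem
matches every unit at some `x_i` with its own unit at some `y_j ≥ x_i` (`exists_matching`). Summing
over the units compares `q · ∑ r_i x_i` with `∑ s_j y_j`, and the supremum over `q < 1` removes the
factor.

For the basis (`simple_basis`), `∑ r_i δ_{x_i}` is the directed supremum of the valuations `q ∑ r_i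
δ_{x'_i}` with `q < 1` and `x'_i ≪ x_i`, and these are way-below it (`wayBelow_simple`). Having a
basis of simple valuations passes to directed suprema, hence holds at every point of `M K`. -/

lemma WayBelow.le {x y : D} (h : WayBelow x y) : x ≤ y := by
  obtain ⟨a, rfl, ha⟩ := h {y} (singleton_nonempty y) (directedOn_singleton _) y
    isLUB_singleton le_rfl
  exact ha

lemma WayBelow.trans_le {x y z : D} (h : WayBelow x y) (hyz : y ≤ z) : WayBelow x z :=
  fun A h0 hA s hs hz => h A h0 hA s hs (hyz.trans hz)

lemma WayBelow.le_trans {x y z : D} (hxy : x ≤ y) (h : WayBelow y z) : WayBelow x z :=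
  fun A h0 hA s hs hz => by
    obtain ⟨a, ha, hya⟩ := h A h0 hA s hs hz
    exact ⟨a, ha, hxy.trans hya⟩

/-- The elements of `B` way-below `x` form a directed set with supremum `x`. -/
def BasisAt (B : Set D) (x : D) : Prop :=
  {b | b ∈ B ∧ WayBelow b x}.Nonempty ∧ DirectedOn (· ≤ ·) {b | b ∈ B ∧ WayBelow b x} ∧
    IsLUB {b | b ∈ B ∧ WayBelow b x} x

/-- The basis elements way-below some member of a directed set with supremum `a` form a directed
set with supremum `a`. -/
lemma directed_iUnion_wayBelow {B : Set D} {d : Set D} (h0 : d.Nonempty)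
    (hd : DirectedOn (· ≤ ·) d)
    (hB : ∀ y ∈ d, BasisAt B y)
    {a : D} (ha : IsLUB d a) :
    {b | ∃ y ∈ d, b ∈ B ∧ WayBelow b y}.Nonempty ∧
      DirectedOn (· ≤ ·) {b | ∃ y ∈ d, b ∈ B ∧ WayBelow b y} ∧
      IsLUB {b | ∃ y ∈ d, b ∈ B ∧ WayBelow b y} a := by
  refine ⟨?_, ?_, ?_, ?_⟩
  · obtain ⟨y, hy⟩ := h0
    obtain ⟨b, hb⟩ := (hB y hy).1
    exact ⟨b, y, hy, hb⟩
  · rintro b ⟨y, hy, hbB, hby⟩ c ⟨z, hz, hcB, hcz⟩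
    obtain ⟨w, hw, hyw, hzw⟩ := hd y hy z hz
    obtain ⟨e, he, hbe, hce⟩ := (hB w hw).2.1 b ⟨hbB, hby.trans_le hyw⟩ c ⟨hcB, hcz.trans_le hzw⟩
    exact ⟨e, ⟨w, hw, he⟩, hbe, hce⟩
  · rintro b ⟨y, hy, -, hby⟩
    exact hby.le.trans (ha.1 hy)
  · intro c hc
    exact ha.2 fun y hy => (hB y hy).2.2.2 fun b hb => hc ⟨y, hy, hb⟩

/-- The basis elements way-below members of `d` are again directed with supremum `a`, so one of them
lies above `x`. This makes way-above sets Scott-open and the barycenter map Scott-continuous. -/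
lemma WayBelow.exists_of_isLUB [IsDomainDcpo D] {x a : D} (h : WayBelow x a) {d : Set D}
    (h0 : d.Nonempty) (hd : DirectedOn (· ≤ ·) d) (ha : IsLUB d a) : ∃ y ∈ d, WayBelow x y := by
  obtain ⟨B, hB⟩ := IsDomainDcpo.exists_basis (D := D)
  obtain ⟨h0', hd', ha'⟩ := directed_iUnion_wayBelow h0 hd (fun y _ => hB y) ha
  obtain ⟨b, ⟨y, hy, -, hby⟩, hxb⟩ := h _ h0' hd' a ha' le_rfl
  exact ⟨y, hy, hby.le_trans hxb⟩

lemma wayBelow_directed [IsDomainDcpo D] (x : D) :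
    {y | WayBelow y x}.Nonempty ∧ DirectedOn (· ≤ ·) {y | WayBelow y x} ∧
      IsLUB {y | WayBelow y x} x := by
  obtain ⟨B, hB⟩ := IsDomainDcpo.exists_basis (D := D)
  obtain ⟨⟨b, hb⟩, hd, hx⟩ := hB x
  refine ⟨⟨b, hb.2⟩, fun y hy z hz => ?_, fun y hy => hy.le, fun c hc => hx.2 fun b hb => hc hb.2⟩
  obtain ⟨b, hb, hyb⟩ := hy _ ⟨b, hb⟩ hd x hx le_rfl
  obtain ⟨c, hc, hzc⟩ := hz _ ⟨b, hb⟩ hd x hx le_rfl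
  obtain ⟨e, he, hbe, hce⟩ := hd b hb c hc
  exact ⟨e, he.2, hyb.trans hbe, hzc.trans hce⟩

/-- The Scott-open set of the points that some `x i`, with `i ∈ J`, is way-below. -/
def wayAbove {D : Type u} [PartialOrder D] [IsDomainDcpo D] {ι : Type*} (J : Finset ι)
    (x : ι → D) : Opens (WithScott D) where
  carrier := {y | ∃ i ∈ J, WayBelow (x i) (WithScott.ofScott y)}
  is_open' := by
    rw [IsScott.isOpen_iff_isUpperSet_and_dirSupInaccOn (D := univ)]
    refine ⟨fun y z hyz ⟨i, hi, h⟩ => ⟨i, hi, h.trans_le hyz⟩, fun d _ h0 hd a ha ⟨i, hi, h⟩ => ?_⟩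
    obtain ⟨y, hy, hxy⟩ := WayBelow.exists_of_isLUB (D := D) h h0 hd ha
    exact ⟨y, hy, i, hi, hxy⟩

/-- The Scott-open set of the points that lie below no `y j`, with `j ∈ J`. -/
def notBelow {D : Type u} [PartialOrder D] {ι : Type*} (J : Finset ι) (y : ι → D) :
    Opens (WithScott D) where
  carrier := {z | ∀ j ∈ J, ¬ WithScott.ofScott z ≤ y j}
  is_open' := by
    have : {z : WithScott D | ∀ j ∈ J, ¬ WithScott.ofScott z ≤ y j} =
        ⋂ j ∈ J, (closure {WithScott.toScott (y j)})ᶜ := by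
      ext z
      simp only [IsScott.closure_singleton, mem_ofPred_eq, mem_iInter, mem_compl_iff, mem_Iic]
      rfl
    rw [this]
    exact isOpen_biInter_finset fun j _ => isClosed_closure.isOpen_compl

end WayBelow

/-! ### Real weights -/

section RealMix

variable {A : Type*} [PointedBarycentricAlgebra A]

/-- `a +_t b` for a real number `t`, projected to `[0,1]`. -/
def rmix (t : ℝ) (a b : A) : A := mix (projIcc 0 1 zero_le_one t) a b

/-- `t · a = a +_t ⊥`. -/
def rsmul (t : ℝ) (a : A) : A := rmix t a pt

lemma mix_eq_rmix (r : I) (a b : A) : mix r a b = rmix (r : ℝ) a b := by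
  rw [rmix, projIcc_val]

lemma rmix_of_mem {t : ℝ} (ht : t ∈ Icc (0 : ℝ) 1) (a b : A) : rmix t a b = mix ⟨t, ht⟩ a b := by
  rw [rmix, projIcc_of_mem]

lemma rmix_one (a b : A) : rmix 1 a b = a := by
  rw [rmix, projIcc_right]; exact mix_one a b

lemma rmix_symm {t : ℝ} (h0 : 0 ≤ t) (h1 : t ≤ 1) (a b : A) : rmix t a b = rmix (1 - t) b a := by
  rw [rmix_of_mem ⟨h0, h1⟩, rmix_of_mem (t := 1 - t) ⟨by linarith, by linarith⟩, mix_symm]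
  rfl

lemma rmix_zero (a b : A) : rmix 0 a b = b := by
  rw [rmix_symm le_rfl zero_le_one, sub_zero, rmix_one]

lemma rmix_self (t : ℝ) (a : A) : rmix t a a = a := mix_self _ a

/-- The quotient of the associativity law enters through a cross-multiplied equation, which callers
can settle by ring arithmetic. The weights `s` and `q` then lie in `[0,1]`, so the projection inside
`rmix` does nothing. -/
lemma rmix_assoc {r p q s : ℝ} (hr0 : 0 ≤ r) (hr : r < 1) (hp0 : 0 ≤ p) (hp : p < 1)
    (hs : s = p * r) (hq : q * (1 - s) = r - s) (a b c : A) :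
    rmix r (rmix p a b) c = rmix s a (rmix q b c) := by
  have h1 : s ≤ r := by rw [hs]; exact mul_le_of_le_one_left hr0 hp.le
  have h0 : 0 ≤ s := by rw [hs]; positivity
  have hq' : q = (r - s) / (1 - s) := by rw [← hq, mul_div_cancel_right₀]; linarith
  have hq0 : 0 ≤ q := by rw [hq']; exact div_nonneg (by linarith) (by linarith)
  have hq1 : q ≤ 1 := by rw [hq', div_le_one (by linarith)]; linarith
  rw [rmix_of_mem ⟨hr0, hr.le⟩, rmix_of_mem ⟨hp0, hp.le⟩, rmix_of_mem ⟨hq0, hq1⟩,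
    rmix_of_mem ⟨h0, by linarith⟩, mix_assoc _ _ ⟨q, hq0, hq1⟩ a b c hr hp (by simp [hq', hs])]
  congr 1
  exact Subtype.ext hs.symm

lemma rsmul_pt (t : ℝ) : rsmul t (pt : A) = pt := rmix_self t _

lemma rsmul_one (a : A) : rsmul 1 a = a := rmix_one a _

/-- Associativity with the last two arguments equal to `⊥`. The law requires both weights below `1`,
so the weight `1` is treated apart. -/
lemma rsmul_rsmul {s t : ℝ} (hs0 : 0 ≤ s) (hs : s ≤ 1) (ht0 : 0 ≤ t) (ht : t ≤ 1) (a : A) :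
    rsmul s (rsmul t a) = rsmul (s * t) a := by
  rcases hs.eq_or_lt with rfl | hs
  · rw [rsmul_one, one_mul]
  rcases ht.eq_or_lt with rfl | ht
  · rw [rsmul_one, mul_one]
  have h : s * t < 1 := by nlinarith
  rw [rsmul, rsmul, rmix_assoc (s := s * t) (q := (s - s * t) / (1 - s * t)) hs0 hs ht0 ht
    (mul_comm _ _) (by rw [div_mul_cancel₀]; linarith), rmix_self, rsmul]

/-- `t · (a +_p b)` as the midpoint of `2tp · a` and `2t(1-p) · b`. -/
lemma rsmul_rmix {t p x y : ℝ} (hp0 : 0 ≤ p) (hp : p < 1) (ht0 : 0 ≤ t) (ht : t < 1 / 2)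
    (hx : x = 2 * (t * p)) (hy : y = 2 * (t * (1 - p))) (a b : A) :
    rsmul t (rmix p a b) = rmix (1 / 2) (rsmul x a) (rsmul y b) := by
  have h1 : t * p ≤ t := mul_le_of_le_one_right ht0 hp.le
  have h2 : 0 ≤ t * p := mul_nonneg ht0 hp0
  have h3 : (1 - t * p) ≠ 0 := by linarith
  -- Associativity brings both sides to the form `a +_{tp} (c · b)`; it remains to compare the two
  -- scalars `c`.
  have e1 : rsmul t (rmix p a b) = rmix (t * p) a (rsmul (t * (1 - p) / (1 - t * p)) b) := by
    rw [rsmul, rsmul, rmix_assoc ht0 (by linarith) hp0 hp (mul_comm _ _)]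
    field_simp
  have h4 : (1 / 2 - t * p) / (1 - t * p) ≤ 1 := by
    rw [div_le_one (by linarith)]; linarith
  have h5 : 0 ≤ (1 / 2 - t * p) / (1 - t * p) := div_nonneg (by linarith) (by linarith)
  have e2 : rmix (1 / 2) (rsmul x a) (rsmul y b) =
      rmix (t * p) a (rmix ((1 / 2 - t * p) / (1 - t * p)) pt (rsmul y b)) := by
    rw [rsmul, rmix_assoc (s := t * p) (q := (1 / 2 - t * p) / (1 - t * p)) (by norm_num)
      (by norm_num) (by linarith) (by linarith) (by linarith) (div_mul_cancel₀ _ h3)]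
  rw [e1, e2, rmix_symm h5 h4, ← rsmul, rsmul_rsmul (by linarith) (by linarith)]
  · congr 2
    rw [hy]
    field_simp
    ring
  · rw [hy]; nlinarith
  · rw [hy]; nlinarith

end RealMix

/-! ### Kegelspitzen -/

section Kegelspitze

variable {K : Type*} [PartialOrder K] [PointedBarycentricAlgebra K] [IsKegelspitze K]

lemma mix_mono (r : I) {a a' b b' : K} (ha : a ≤ a') (hb : b ≤ b') : mix r a b ≤ mix r a' b' :=
  (IsKegelspitze.mix_scottContinuous (K := K) r).monotone (a := (a, b)) (b := (a', b')) ⟨ha, hb⟩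

lemma rmix_mono (t : ℝ) {a a' b b' : K} (ha : a ≤ a') (hb : b ≤ b') :
    rmix t a b ≤ rmix t a' b' := mix_mono _ ha hb

lemma rsmul_mono {s t : ℝ} (hst : s ≤ t) {a b : K} (hab : a ≤ b) : rsmul s a ≤ rsmul t b :=
  (IsKegelspitze.smul_scottContinuous (K := K)).monotone
    (a := (projIcc 0 1 zero_le_one s, a)) (b := (projIcc 0 1 zero_le_one t, b))
    ⟨monotone_projIcc zero_le_one hst, hab⟩

/-- This is monotonicity in the scalar, applied to `0 · a = ⊥` and `1 · a = a`. -/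
lemma pt_le (a : K) : pt ≤ a := by
  have := rsmul_mono zero_le_one (le_refl a)
  rwa [rsmul_one, rsmul, rmix_zero] at this

/-- Joint Scott-continuity of scalar multiplication, restricted to the directed set `S × {a}`. -/
lemma isLUB_smul {S : Set I} (h0 : S.Nonempty) {p : I} (hp : IsLUB S p) (a : K) :
    IsLUB ((fun r : I => mix r a pt) '' S) (mix p a pt) := by
  have h := IsKegelspitze.smul_scottContinuous (K := K) (d := S ×ˢ {a}) (a := (p, a))
    (h0.prod (singleton_nonempty a)) ?_ ?_
  · rw [prod_singleton, image_image] at h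
    exact h
  · rintro ⟨x, _⟩ ⟨hx, rfl⟩ ⟨y, _⟩ ⟨hy, rfl⟩
    rcases le_total x y with h | h
    · exact ⟨(y, _), ⟨hy, rfl⟩, ⟨h, le_rfl⟩, le_rfl⟩
    · exact ⟨(x, _), ⟨hx, rfl⟩, le_rfl, ⟨h, le_rfl⟩⟩
  · rw [isLUB_prod, fst_image_prod _ (singleton_nonempty a), snd_image_prod h0]
    exact ⟨hp, isLUB_singleton⟩

lemma isLUB_unitInterval_lt_one : IsLUB {q : I | q < 1} 1 := isLUB_Iio

lemma le_of_forall_rsmul_le {a b : K} (h : ∀ q : ℝ, 0 < q → q < 1 → rsmul q a ≤ b) : a ≤ b := by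
  have h1 := isLUB_smul (S := {q : I | q < 1}) ⟨0, show (0 : I) < 1 from zero_lt_one⟩
    isLUB_unitInterval_lt_one a
  rw [mix_one] at h1
  refine h1.2 ?_
  rintro _ ⟨q, hq, rfl⟩
  rcases eq_or_lt_of_le q.2.1 with h0 | h0
  · simp only [mix_eq_rmix, ← h0, rmix_zero]
    exact pt_le b
  · simp only [mix_eq_rmix]
    exact h q h0 hq

/-- The choice of `q` makes `q · (c +_{1/2} d) = c +_{q/2} (p · d)`. The hypothesis thus replaces
one copy of `a` in `q · (a +_{1/2} a)` by `b`; commutativity of the midpoint moves the other copy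
into the same place, and a second use replaces it. -/
lemma rsmul_le_rsmul_step {p q : ℝ} (hp0 : 0 ≤ p) (hp : p < 1) (hq : q * (1 + p) = 2 * p) {a b : K}
    (h : rsmul p a ≤ rsmul p b) : rsmul q a ≤ rsmul q b := by
  have hq0 : 0 ≤ q := by
    have : q = 2 * p / (1 + p) := by rw [← hq, mul_div_cancel_right₀]; linarith
    rw [this]; positivity
  have hq1 : q < 1 := by nlinarith
  have key : ∀ c d : K, rsmul q (rmix (1 / 2) c d) = rmix (q / 2) c (rsmul p d) := fun c d =>
    rmix_assoc hq0 hq1 (by norm_num) (by norm_num) (by ring) (by linarith) c d pt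
  have hs : rmix (1 / 2) a b = rmix (1 / 2) b a := by
    rw [rmix_symm (by norm_num) (by norm_num)]; norm_num
  calc rsmul q a = rmix (q / 2) a (rsmul p a) := by rw [← key, rmix_self]
    _ ≤ rmix (q / 2) a (rsmul p b) := rmix_mono _ le_rfl h
    _ = rmix (q / 2) b (rsmul p a) := by rw [← key, hs, key]
    _ ≤ rmix (q / 2) b (rsmul p b) := rmix_mono _ le_rfl h
    _ = rsmul q b := by rw [← key, rmix_self]

/-- Scalar multiplication by a positive number reflects the order. -/
lemma le_of_rsmul_le_rsmul {p : ℝ} (hp0 : 0 < p) (hp1 : p ≤ 1) {a b : K}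
    (h : rsmul p a ≤ rsmul p b) : a ≤ b := by
  -- `T` is closed under suprema, so it contains its supremum `s`. If `s < 1`, the previous lemma
  -- puts `2s / (1 + s)` into `T`, which exceeds `s` because `0 < s < 1`.
  let T : Set I := {q | mix q a pt ≤ mix q b pt}
  have hpT : (⟨p, hp0.le, hp1⟩ : I) ∈ T := by
    change mix _ _ _ ≤ mix _ _ _
    rw [mix_eq_rmix, mix_eq_rmix]; exact h
  have hs := isLUB_sSup T
  have hsT : sSup T ∈ T := by
    refine (isLUB_smul ⟨_, hpT⟩ hs a).2 ?_
    rintro _ ⟨q, hq, rfl⟩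
    exact le_trans hq ((isLUB_smul ⟨_, hpT⟩ hs b).1 ⟨q, hq, rfl⟩)
  rcases eq_or_lt_of_le (show sSup T ≤ 1 from (sSup T).2.2) with h1 | h1
  · rw [h1] at hsT
    simpa only [T, mem_ofPred_eq, mix_one] using hsT
  · exfalso
    have hs0 : (0 : ℝ) < sSup T := hp0.trans_le (hs.1 hpT)
    have hs1 : ((sSup T : I) : ℝ) < 1 := h1
    have hq : 2 * ((sSup T : I) : ℝ) / (1 + sSup T) ∈ Icc (0 : ℝ) 1 :=
      ⟨by positivity, by rw [div_le_one (by linarith)]; linarith⟩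
    have hqT : (⟨_, hq⟩ : I) ∈ T := by
      change mix _ _ _ ≤ mix _ _ _
      rw [mix_eq_rmix, mix_eq_rmix]
      refine rsmul_le_rsmul_step hs0.le hs1 (div_mul_cancel₀ _ (by linarith)) ?_
      rw [rsmul, rsmul, ← mix_eq_rmix, ← mix_eq_rmix]
      exact hsT
    have hle : 2 * ((sSup T : I) : ℝ) / (1 + sSup T) ≤ sSup T := hs.1 hqT
    rw [div_le_iff₀ (by linarith)] at hle
    nlinarith

end Kegelspitze

/-! ### The cone of a Kegelspitze -/

/-- A formal positive multiple `scale · point`. -/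
@[ext]
structure ScaledPoint (K : Type*) where
  scale : ℝ
  point : K
  scale_pos : 0 < scale

namespace ScaledPoint

section Algebra

variable {K : Type*} [PointedBarycentricAlgebra K]

instance : Add (ScaledPoint K) where
  add a b := ⟨a.scale + b.scale, rmix (a.scale / (a.scale + b.scale)) a.point b.point,
    add_pos a.scale_pos b.scale_pos⟩

lemma add_scale (a b : ScaledPoint K) : (a + b).scale = a.scale + b.scale := rfl

lemma add_point (a b : ScaledPoint K) :
    (a + b).point = rmix (a.scale / (a.scale + b.scale)) a.point b.point := rfl

lemma add_comm' (a b : ScaledPoint K) : a + b = b + a := by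
  have ha := a.scale_pos
  have hb := b.scale_pos
  ext
  · simp only [add_scale, add_comm]
  · rw [add_point, add_point, rmix_symm (by positivity) (by rw [div_le_one] <;> linarith)]
    congr 1
    field_simp
    ring

lemma add_assoc' (a b c : ScaledPoint K) : a + b + c = a + (b + c) := by
  have ha := a.scale_pos
  have hb := b.scale_pos
  have hc := c.scale_pos
  ext
  · simp only [add_scale, add_assoc]
  · simp only [add_point, add_scale]
    refine rmix_assoc (by positivity) (by rw [div_lt_one] <;> linarith) (by positivity)
      (by rw [div_lt_one] <;> linarith) ?_ ?_ _ _ _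
    · field_simp
      ring
    · field_simp
      ring

/-- `ε · (scale · point)`, for small `ε`. -/
def eval (ε : ℝ) (a : ScaledPoint K) : K := rsmul (ε * a.scale) a.point

lemma eventually_small (c : ℝ) : ∀ᶠ ε : ℝ in 𝓝[>] 0, 0 < ε ∧ ε * c < 1 := by
  have h : Filter.Tendsto (fun ε : ℝ => ε * c) (𝓝[>] 0) (𝓝 (0 * c)) :=
    ((continuous_id.mul continuous_const).tendsto 0).mono_left nhdsWithin_le_nhds
  rw [zero_mul] at h
  exact (eventually_mem_nhdsWithin (s := Ioi (0 : ℝ))).and (h.eventually_lt_const zero_lt_one)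

/-- Sums of formal multiples evaluated at `ε` involve the summands evaluated at `2ε`. -/
lemma eventually_double {P : ℝ → Prop} (h : ∀ᶠ ε in 𝓝[>] (0 : ℝ), P ε) :
    ∀ᶠ ε in 𝓝[>] (0 : ℝ), P (2 * ε) := by
  refine Filter.Tendsto.eventually (f := fun ε : ℝ => 2 * ε) ?_ h
  refine tendsto_nhdsWithin_iff.2 ⟨?_, ?_⟩
  · have h : Filter.Tendsto (fun ε : ℝ => 2 * ε) (𝓝[>] 0) (𝓝 (2 * 0)) :=
      ((continuous_const.mul continuous_id).tendsto 0).mono_left nhdsWithin_le_nhds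
    rwa [mul_zero] at h
  · filter_upwards [eventually_mem_nhdsWithin (s := Ioi (0 : ℝ))] with ε hε
    exact mul_pos two_pos (mem_Ioi.1 hε)

/-- `K` has midpoints but no sums, so the sum at scale `ε` is expressed as a midpoint at scale `2ε`.
In this form, monotonicity of `+_{1/2}` yields monotonicity of addition. -/
lemma eventually_eval_add (a b : ScaledPoint K) : ∀ᶠ ε in 𝓝[>] (0 : ℝ),
    eval ε (a + b) = rmix (1 / 2) (eval (2 * ε) a) (eval (2 * ε) b) := by
  have ha := a.scale_pos
  have hb := b.scale_pos
  filter_upwards [eventually_small (2 * (a.scale + b.scale))] with ε hε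
  refine rsmul_rmix (by positivity) (by rw [div_lt_one] <;> linarith) (mul_nonneg hε.1.le
    (add_pos ha hb).le) (by linarith) ?_ ?_ _ _
  · field_simp
  · field_simp; ring

lemma eventually_eval_pt_add (a : ScaledPoint K) : ∀ᶠ ε in 𝓝[>] (0 : ℝ),
    eval ε (⟨1, pt, one_pos⟩ + a) = eval ε a := by
  have ha := a.scale_pos
  filter_upwards [eventually_eval_add ⟨1, pt, one_pos⟩ a, eventually_small (2 * a.scale)]
    with ε h1 hε
  have h0 : 0 ≤ 2 * ε * a.scale := by have := hε.1; positivity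
  rw [h1, eval, eval, rsmul_pt, rmix_symm (by norm_num) (by norm_num), ← rsmul,
    rsmul_rsmul (by norm_num) (by norm_num) h0 (by linarith), eval]
  congr 1
  ring

end Algebra

section Order

variable {K : Type*} [PartialOrder K] [PointedBarycentricAlgebra K]

/-- Two formal multiples are compared after shrinking both into `K`. Asking only for small `ε` keeps
the factors in `[0,1]`, where the projection in `rsmul` does nothing, and lets finitely many
smallness conditions be combined. -/
instance : Preorder (ScaledPoint K) where
  le a b := ∀ᶠ ε in 𝓝[>] (0 : ℝ), eval ε a ≤ eval ε b
  le_refl _ := Filter.Eventually.of_forall fun _ => le_rfl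
  le_trans _ _ _ h h' := by filter_upwards [h, h'] with ε using le_trans

lemma le_def {a b : ScaledPoint K} : a ≤ b ↔ ∀ᶠ ε in 𝓝[>] (0 : ℝ), eval ε a ≤ eval ε b := Iff.rfl

lemma le_of_eventually_eq {a b : ScaledPoint K}
    (h : ∀ᶠ ε in 𝓝[>] (0 : ℝ), eval ε a = eval ε b) : a ≤ b := h.mono fun _ => le_of_eq

variable [IsKegelspitze K]

lemma add_le_add' {a a' b b' : ScaledPoint K} (ha : a ≤ a') (hb : b ≤ b') :
    a + b ≤ a' + b' := by
  rw [le_def] at *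
  filter_upwards [eventually_eval_add a b, eventually_eval_add a' b', eventually_double ha,
    eventually_double hb] with ε h1 h2 h3 h4
  rw [h1, h2]
  exact rmix_mono _ h3 h4

end Order

end ScaledPoint

/-! ### The quotient cone and the embedding of `K`. -/

section Cone

variable (K : Type*) [PartialOrder K] [PointedBarycentricAlgebra K]

/-- The cone of formal nonnegative multiples of elements of a Kegelspitze. -/
def Cone : Type _ := Antisymmetrization (ScaledPoint K) (· ≤ ·)

instance : PartialOrder (Cone K) :=
  inferInstanceAs (PartialOrder (Antisymmetrization (ScaledPoint K) (· ≤ ·)))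

variable {K}

/-- The class of a formal multiple. -/
def Cone.mk (a : ScaledPoint K) : Cone K := toAntisymmetrization (· ≤ ·) a

lemma Cone.mk_le_mk {a b : ScaledPoint K} : Cone.mk a ≤ Cone.mk b ↔ a ≤ b := Iff.rfl

lemma Cone.mk_eq_of_eventually {a b : ScaledPoint K}
    (h : ∀ᶠ ε in 𝓝[>] (0 : ℝ), a.eval ε = b.eval ε) : Cone.mk a = Cone.mk b :=
  le_antisymm (Cone.mk_le_mk.2 (ScaledPoint.le_of_eventually_eq h))
    (Cone.mk_le_mk.2 (ScaledPoint.le_of_eventually_eq (h.mono fun _ => Eq.symm)))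

lemma Cone.ind {P : Cone K → Prop} (h : ∀ a, P (Cone.mk a)) (c : Cone K) : P c :=
  Antisymmetrization.ind _ h c

/-- The scale `1` is arbitrary, since all multiples of `⊥` are identified (`Cone.mk_pt`). -/
instance : Zero (Cone K) where
  zero := Cone.mk ⟨1, pt, one_pos⟩

lemma Cone.mk_pt {r : ℝ} (hr : 0 < r) : Cone.mk ⟨r, (pt : K), hr⟩ = 0 :=
  Cone.mk_eq_of_eventually (Filter.Eventually.of_forall fun ε => by
    simp only [ScaledPoint.eval, rsmul_pt])

/-- The element `r · x` of the cone. -/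
def Cone.single (r : ℝ) (x : K) : Cone K := if h : 0 < r then Cone.mk ⟨r, x, h⟩ else 0

lemma Cone.single_of_pos {r : ℝ} (h : 0 < r) (x : K) : Cone.single r x = Cone.mk ⟨r, x, h⟩ :=
  dif_pos h

lemma Cone.single_zero (x : K) : Cone.single 0 x = 0 := dif_neg (lt_irrefl 0)

lemma Cone.single_pt (r : ℝ) : Cone.single r (pt : K) = 0 := by
  unfold Cone.single
  split_ifs with h
  · exact Cone.mk_pt h
  · rfl

variable [IsKegelspitze K]

instance : Add (Cone K) where
  add := Quotient.map₂ (· + ·) fun _ _ h _ _ h' =>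
    ⟨ScaledPoint.add_le_add' h.1 h'.1, ScaledPoint.add_le_add' h.2 h'.2⟩

lemma Cone.mk_add (a b : ScaledPoint K) : Cone.mk (a + b) = Cone.mk a + Cone.mk b := rfl

lemma Cone.zero_add' (a : Cone K) : 0 + a = a := by
  induction a using Cone.ind with
  | h a => exact Cone.mk_eq_of_eventually (ScaledPoint.eventually_eval_pt_add a)

lemma Cone.add_comm' (a b : Cone K) : a + b = b + a := by
  induction a using Cone.ind with
  | h a =>
    induction b using Cone.ind with
    | h b => exact congrArg Cone.mk (a.add_comm' b)

instance : AddCommMonoid (Cone K) where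
  add_assoc a b c := by
    induction a using Cone.ind with
    | h a =>
      induction b using Cone.ind with
      | h b =>
        induction c using Cone.ind with
        | h c => exact congrArg Cone.mk (a.add_assoc' b c)
  zero_add := Cone.zero_add'
  add_zero a := (Cone.add_comm' a 0).trans (Cone.zero_add' a)
  add_comm := Cone.add_comm'
  nsmul := nsmulRec

instance : IsOrderedAddMonoid (Cone K) where
  add_le_add_left a b h c := by
    induction a using Cone.ind with
    | h a =>
      induction b using Cone.ind with
      | h b =>
        induction c using Cone.ind with
        | h c => exact Cone.mk_le_mk.2 (ScaledPoint.add_le_add' h le_rfl)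

lemma Cone.zero_le' (a : Cone K) : 0 ≤ a := by
  induction a using Cone.ind with
  | h a =>
    refine Cone.mk_le_mk.2 (Filter.Eventually.of_forall fun ε => ?_)
    rw [ScaledPoint.eval, rsmul_pt]
    exact pt_le _

lemma Cone.single_add {r s : ℝ} (hr : 0 ≤ r) (hs : 0 ≤ s) (x : K) :
    Cone.single (r + s) x = Cone.single r x + Cone.single s x := by
  rcases hr.eq_or_lt with rfl | hr
  · rw [single_zero, zero_add, zero_add]
  rcases hs.eq_or_lt with rfl | hs
  · rw [single_zero, add_zero, add_zero]
  rw [single_of_pos (add_pos hr hs), single_of_pos hr, single_of_pos hs, ← mk_add]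
  congr 1
  ext
  · rfl
  · exact (rmix_self _ x).symm

lemma Cone.single_nsmul (n : ℕ) {r : ℝ} (hr : 0 ≤ r) (x : K) :
    Cone.single (n * r) x = n • Cone.single r x := by
  induction n with
  | zero => rw [Nat.cast_zero, zero_mul, single_zero, zero_smul]
  | succ n ih =>
    rw [Nat.cast_succ, add_mul, one_mul, single_add (by positivity) hr, ih, succ_nsmul]

lemma Cone.single_mono_left {r s : ℝ} (hr : 0 ≤ r) (hrs : r ≤ s) (x : K) :
    Cone.single r x ≤ Cone.single s x := by
  have := Cone.single_add hr (sub_nonneg.2 hrs) x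
  rw [add_sub_cancel] at this
  rw [this]
  exact le_add_of_nonneg_right (Cone.zero_le' _)

lemma Cone.single_mono_right (r : ℝ) {x y : K} (h : x ≤ y) :
    Cone.single r x ≤ Cone.single r y := by
  unfold Cone.single
  split_ifs
  · exact Cone.mk_le_mk.2 (Filter.Eventually.of_forall fun ε => rsmul_mono le_rfl h)
  · exact le_rfl

lemma Cone.single_rmix {r p : ℝ} (hr : 0 ≤ r) (hp0 : 0 ≤ p) (hp1 : p ≤ 1) (a b : K) :
    Cone.single r (rmix p a b) = Cone.single (r * p) a + Cone.single (r * (1 - p)) b := by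
  -- Formal multiples have positive scale, so each vanishing weight is treated separately.
  rcases hr.eq_or_lt with rfl | hr
  · simp only [zero_mul, single_zero, add_zero]
  rcases hp0.eq_or_lt with rfl | hp0
  · rw [rmix_zero, mul_zero, single_zero, zero_add, sub_zero, mul_one]
  rcases hp1.eq_or_lt with rfl | hp1
  · rw [rmix_one, sub_self, mul_zero, single_zero, add_zero, mul_one]
  rw [single_of_pos hr, single_of_pos (mul_pos hr hp0), single_of_pos (mul_pos hr (sub_pos.2 hp1)),
    ← mk_add]
  congr 1
  ext
  · simp only [ScaledPoint.add_scale]; ring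
  · simp only [ScaledPoint.add_point]
    congr 1
    field_simp
    ring

/-- The order of the cone gives the comparison after scaling by some `ε > 0`, and scaling reflects
the order of `K`. -/
lemma Cone.le_of_single_le {a b : K} (h : Cone.single 1 a ≤ Cone.single 1 b) : a ≤ b := by
  rw [single_of_pos one_pos, single_of_pos one_pos, mk_le_mk, ScaledPoint.le_def] at h
  obtain ⟨ε, h1, h2⟩ := (h.and (ScaledPoint.eventually_small 1)).exists
  exact le_of_rsmul_le_rsmul (by linarith) (by linarith) h1

end Cone

/-! ### Convex sums -/

section ConvexSum

/-- The projection in the definition of `convexSum` is inert, so the rescaled weights multiply back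
to the original ones. -/
lemma convexSum_weight {n : ℕ} {r : Fin (n + 1) → I} (hr : ∑ i, (r i : ℝ) ≤ 1) (h0 : r 0 ≠ 1)
    (i : Fin n) : (1 - (r 0 : ℝ)) *
      (projIcc (0 : ℝ) 1 zero_le_one ((r i.succ : ℝ) / (1 - r 0)) : I) = r i.succ := by
  have h1 : (0 : ℝ) < 1 - r 0 := sub_pos.2 (lt_of_le_of_ne (r 0).2.2 fun h => h0 (Subtype.ext h))
  have h2 : (r i.succ : ℝ) ≤ 1 - r 0 := by
    rw [Fin.sum_univ_succ] at hr
    have := Finset.single_le_sum (f := fun i : Fin n => (r i.succ : ℝ))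
      (fun i _ => (r i.succ).2.1) (Finset.mem_univ i)
    linarith
  rw [projIcc_of_mem _ ⟨div_nonneg (r i.succ).2.1 h1.le, (div_le_one h1).2 h2⟩]
  exact mul_div_cancel₀ _ h1.ne'

lemma convexSum_weight_sum {n : ℕ} {r : Fin (n + 1) → I} (hr : ∑ i, (r i : ℝ) ≤ 1)
    (h0 : r 0 ≠ 1) :
    ∑ i : Fin n, ((projIcc (0 : ℝ) 1 zero_le_one ((r i.succ : ℝ) / (1 - r 0)) : I) : ℝ) ≤ 1 := by
  have h1 : (0 : ℝ) < 1 - r 0 := sub_pos.2 (lt_of_le_of_ne (r 0).2.2 fun h => h0 (Subtype.ext h))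
  refine le_of_mul_le_mul_left ?_ h1
  rw [Finset.mul_sum, Finset.sum_congr rfl fun i _ => convexSum_weight hr h0 i]
  rw [Fin.sum_univ_succ] at hr
  linarith

lemma weight_eq_zero {n : ℕ} {r : Fin (n + 1) → I} (hr : ∑ i, (r i : ℝ) ≤ 1) (h0 : r 0 = 1)
    (i : Fin n) : (r i.succ : ℝ) = 0 := by
  rw [Fin.sum_univ_succ, h0] at hr
  have := Finset.single_le_sum (f := fun i : Fin n => (r i.succ : ℝ))
      (fun i _ => (r i.succ).2.1) (Finset.mem_univ i)
  rw [Icc.coe_one] at hr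
  exact le_antisymm (by linarith) (r i.succ).2.1

/-- A convex sum, as an element of the cone, is a sum of multiples. -/
lemma Cone.single_convexSum {K : Type*} [PartialOrder K] [PointedBarycentricAlgebra K]
    [IsKegelspitze K] {n : ℕ} (r : Fin n → I) (hr : ∑ i, (r i : ℝ) ≤ 1) (x : Fin n → K) {t : ℝ}
    (ht : 0 ≤ t) : Cone.single t (convexSum r x) = ∑ i, Cone.single (t * r i) (x i) := by
  induction n generalizing t with
  | zero => rw [Finset.univ_eq_empty, Finset.sum_empty]; exact Cone.single_pt t
  | succ n ih =>
    rw [Fin.sum_univ_succ, convexSum]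
    split_ifs with h0
    · rw [Finset.sum_eq_zero fun i _ => ?_, add_zero, h0, Icc.coe_one, mul_one]
      rw [weight_eq_zero hr h0 i, mul_zero, single_zero]
    · rw [mix_eq_rmix, single_rmix ht (r 0).2.1 (r 0).2.2,
        ih _ (convexSum_weight_sum hr h0) _ (mul_nonneg ht (sub_nonneg.2 (r 0).2.2))]
      simp only [mul_assoc, convexSum_weight hr h0]

lemma convexSum_apply {D : Type u} [PartialOrder D] {n : ℕ} (r : Fin n → I)
    (hr : ∑ i, (r i : ℝ) ≤ 1) (ν : Fin n → MVal D) (U : Opens (WithScott D)) :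
    ((convexSum r ν).1.toFun U : ℝ) = ∑ i, (r i : ℝ) * (ν i).1.toFun U := by
  induction n with
  | zero => rw [Finset.univ_eq_empty, Finset.sum_empty]; rfl
  | succ n ih =>
    rw [Fin.sum_univ_succ, convexSum]
    split_ifs with h0
    · rw [Finset.sum_eq_zero fun i _ => ?_, add_zero, h0, Icc.coe_one, one_mul]
      rw [weight_eq_zero hr h0 i, zero_mul]
    · refine (MVal.mix_apply _ _ _ U).trans ?_
      rw [ih _ (convexSum_weight_sum hr h0), Finset.mul_sum]
      simp only [← mul_assoc, convexSum_weight hr h0]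

lemma IsLinear.map_convexSum {A B : Type*} [PointedBarycentricAlgebra A]
    [PointedBarycentricAlgebra B] {f : A → B} (hf : IsLinear f) {n : ℕ} (r : Fin n → I)
    (x : Fin n → A) : f (convexSum r x) = convexSum r fun i => f (x i) := by
  induction n with
  | zero => exact hf.1
  | succ n ih =>
    rw [convexSum, convexSum]
    split_ifs
    · rfl
    · rw [hf.2, ih]

lemma convexSum_scottContinuous {K : Type*} [PartialOrder K] [PointedBarycentricAlgebra K]
    [IsKegelspitze K] {n : ℕ} (r : Fin n → I) :
    ScottContinuous fun x : Fin n → K => convexSum r x := by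
  induction n with
  | zero => exact ScottContinuous.const _
  | succ n ih =>
    simp only [convexSum]
    split_ifs
    · intro d _ _ a ha
      exact isLUB_pi.1 ha 0
    · have h1 : ScottContinuous fun x : Fin (n + 1) → K => x 0 := fun d _ _ a ha => isLUB_pi.1 ha 0
      have h2 : ScottContinuous fun (x : Fin (n + 1) → K) (i : Fin n) => x i.succ :=
        fun d _ _ a ha => by
          rw [isLUB_pi] at ha ⊢
          intro i
          rw [image_image]
          exact ha i.succ
      exact (h1.prodMk (h2.comp (ih _))).comp (IsKegelspitze.mix_scottContinuous (r 0))

end ConvexSum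

/-! ### Splitting -/

section Splitting

variable {ι κ : Type*} [Fintype ι] [Fintype κ]

/-- Weights `r` and `s` that satisfy Hall's condition with respect to `R` are approximated by
multiples `m i / N` and `n j / N` such that the units of `m` are matched injectively with units of
`n`. -/
lemma exists_matching (R : ι → κ → Prop) (r : ι → ℝ) (s : κ → ℝ) (hr : ∀ i, 0 ≤ r i)
    (hs : ∀ j, 0 ≤ s j)
    (hall : ∀ J : Finset ι, ∑ i ∈ J, r i ≤
      ∑ j, open Classical in if ∃ i ∈ J, R i j then s j else 0)
    {q : ℝ} (hq0 : 0 < q) (hq1 : q < 1) :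
    ∃ (N : ℝ) (m : ι → ℕ) (n : κ → ℕ) (f : (Σ i, Fin (m i)) → Σ j, Fin (n j)), 0 < N ∧
      (∀ i, q * r i ≤ m i * N⁻¹) ∧ (∀ j, n j * N⁻¹ ≤ s j) ∧ Function.Injective f ∧
      ∀ k, R k.1 (f k).1 := by
  classical
  -- Rounding costs at most one unit per index. `N` is taken so large that the slack `N (1 - q) r_i`
  -- of any single positive weight pays for all of it.
  obtain ⟨N, hN, hNr⟩ : ∃ N : ℝ, 0 < N ∧ ∀ i, 0 < r i →
      (Fintype.card ι + Fintype.card κ : ℝ) ≤ N * ((1 - q) * r i) := by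
    have h : ∀ᶠ N : ℝ in Filter.atTop, ∀ i, 0 < r i →
        (Fintype.card ι + Fintype.card κ : ℝ) ≤ N * ((1 - q) * r i) := by
      rw [Filter.eventually_all]
      intro i
      by_cases hi : 0 < r i
      · simp only [hi, true_imp_iff]
        exact (Filter.tendsto_id.atTop_mul_const
          (mul_pos (sub_pos.2 hq1) hi)).eventually_ge_atTop _
      · exact Filter.Eventually.of_forall fun _ h => absurd h hi
    exact ((Filter.eventually_gt_atTop 0).and h).exists
  let m : ι → ℕ := fun i => ⌈N * (q * r i)⌉₊
  let n : κ → ℕ := fun j => ⌊N * s j⌋₊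
  have hm : ∀ i, (m i : ℝ) ≤ N * (q * r i) + 1 := fun i =>
    (Nat.ceil_lt_add_one (by have := hr i; positivity)).le
  have hn : ∀ j, N * s j ≤ n j + 1 := fun j => (Nat.lt_floor_add_one _).le
  have hmn : ∀ J : Finset ι, ∑ i ∈ J, m i ≤ ∑ j, if ∃ i ∈ J, R i j then n j else 0 := by
    intro J
    -- If `J` carries no positive weight there is no slack, but then every `m i` with `i ∈ J` is
    -- zero.
    by_cases hJ : ∃ i ∈ J, 0 < r i
    · obtain ⟨i₀, hi₀, hr₀⟩ := hJ
      have h1 : (∑ i ∈ J, (m i : ℝ)) ≤ N * q * ∑ i ∈ J, r i + Fintype.card ι := by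
        calc (∑ i ∈ J, (m i : ℝ)) ≤ ∑ i ∈ J, (N * (q * r i) + 1) :=
              Finset.sum_le_sum fun i _ => hm i
          _ = N * q * ∑ i ∈ J, r i + J.card := by
              rw [Finset.sum_add_distrib, Finset.mul_sum]
              simp [mul_assoc]
          _ ≤ _ := by gcongr; exact J.card_le_univ
      have h2 : N * ∑ j, (if ∃ i ∈ J, R i j then s j else 0) ≤
          (∑ j, ((if ∃ i ∈ J, R i j then n j else 0 : ℕ) : ℝ)) + Fintype.card κ := by
        rw [Finset.mul_sum]
        calc _ ≤ ∑ j, (((if ∃ i ∈ J, R i j then n j else 0 : ℕ) : ℝ) + 1) := by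
              refine Finset.sum_le_sum fun j _ => ?_
              split_ifs
              · exact hn j
              · simp
          _ = _ := by rw [Finset.sum_add_distrib]; simp
      have h3 : N * ((1 - q) * r i₀) ≤ N * ((1 - q) * ∑ i ∈ J, r i) := by
        have := Finset.single_le_sum (fun i _ => hr i) hi₀
        have := sub_pos.2 hq1
        gcongr
      have h4 := mul_le_mul_of_nonneg_left (hall J) hN.le
      have h5 := hNr i₀ hr₀
      have : (∑ i ∈ J, (m i : ℝ)) ≤ ∑ j, ((if ∃ i ∈ J, R i j then n j else 0 : ℕ) : ℝ) := by
        nlinarith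
      exact_mod_cast this
    · rw [Finset.sum_eq_zero fun i hi => ?_]
      · exact Nat.zero_le _
      · have : r i = 0 := le_antisymm (not_lt.1 fun h => hJ ⟨i, hi, h⟩) (hr i)
        simp [m, this]
  -- Hall's condition for a set `A` of units follows from the one for its set `J` of indices: `A`
  -- has at most as many elements as there are units over `J`, and its neighbours are all the units
  -- over the neighbours of `J`.
  have hcard : ∀ A : Finset (Σ i, Fin (m i)), A.card ≤
      ({b : Σ j, Fin (n j) | ∃ a ∈ A, R a.1 b.1} : Finset _).card := by
    intro A
    let J := A.image Sigma.fst
    have h1 : A ⊆ J.sigma fun i => (Finset.univ : Finset (Fin (m i))) := fun a ha => by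
      simpa [J] using ⟨_, ha⟩
    have h2 : ({b : Σ j, Fin (n j) | ∃ a ∈ A, R a.1 b.1} : Finset _) =
        ({j : κ | ∃ i ∈ J, R i j} : Finset κ).sigma
          fun j => (Finset.univ : Finset (Fin (n j))) := by
      ext b
      simp [J]
    calc A.card ≤ _ := Finset.card_le_card h1
      _ = ∑ i ∈ J, m i := by simp
      _ ≤ _ := hmn J
      _ = _ := by rw [h2, Finset.card_sigma, Finset.sum_filter]; simp
  obtain ⟨f, hf, hfR⟩ := (Fintype.all_card_le_filter_rel_iff_exists_injective
    fun (a : Σ i, Fin (m i)) (b : Σ j, Fin (n j)) => R a.1 b.1).1 hcard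
  refine ⟨N, m, n, f, hN, fun i => ?_, fun j => ?_, hf, hfR⟩
  · rw [← div_eq_mul_inv, le_div_iff₀' hN]
    exact Nat.le_ceil _
  · rw [← div_eq_mul_inv, div_le_iff₀' hN]
    exact Nat.floor_le (mul_nonneg hN.le (hs j))

variable {K : Type*} [PartialOrder K] [PointedBarycentricAlgebra K] [IsKegelspitze K]

lemma Cone.sum_single_nsmul (k : ι → ℕ) {t : ℝ} (ht : 0 ≤ t) (x : ι → K) :
    ∑ i, Cone.single (k i * t) (x i) = ∑ p : Σ i, Fin (k i), Cone.single t (x p.1) := by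
  rw [Fintype.sum_sigma]
  refine Finset.sum_congr rfl fun i _ => ?_
  simp [single_nsmul _ ht]

/-- Both sides are cut into units `N⁻¹ · x_i` and `N⁻¹ · y_j`. Each unit on the left lies below its
match, and the unmatched units on the right are nonnegative. The factor `q < 1` leaves room for the
rounding. -/
lemma Cone.sum_single_le (r : ι → ℝ) (s : κ → ℝ) (hr : ∀ i, 0 ≤ r i) (hs : ∀ j, 0 ≤ s j)
    (x : ι → K) (y : κ → K)
    (hall : ∀ J : Finset ι, ∑ i ∈ J, r i ≤
      ∑ j, open Classical in if ∃ i ∈ J, x i ≤ y j then s j else 0)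
    {q : ℝ} (hq0 : 0 < q) (hq1 : q < 1) :
    ∑ i, Cone.single (q * r i) (x i) ≤ ∑ j, Cone.single (s j) (y j) := by
  classical
  obtain ⟨N, m, n, f, hN, hm, hn, hf, hR⟩ :=
    exists_matching (fun i j => x i ≤ y j) r s hr hs hall hq0 hq1
  have hN' : 0 ≤ N⁻¹ := inv_nonneg.2 hN.le
  calc ∑ i, Cone.single (q * r i) (x i)
      ≤ ∑ i, Cone.single (m i * N⁻¹) (x i) :=
        Finset.sum_le_sum fun i _ => single_mono_left (mul_nonneg hq0.le (hr i)) (hm i) _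
    _ = ∑ a : Σ i, Fin (m i), Cone.single N⁻¹ (x a.1) := sum_single_nsmul m hN' x
    _ ≤ ∑ a : Σ i, Fin (m i), Cone.single N⁻¹ (y (f a).1) :=
        Finset.sum_le_sum fun a _ => single_mono_right _ (hR a)
    _ = ∑ b ∈ Finset.univ.image f, Cone.single N⁻¹ (y b.1) :=
        (Finset.sum_image (f := fun b : Σ j, Fin (n j) => Cone.single N⁻¹ (y b.1)) hf.injOn).symm
    _ ≤ ∑ b : Σ j, Fin (n j), Cone.single N⁻¹ (y b.1) :=
        Finset.sum_le_sum_of_subset_of_nonneg (Finset.subset_univ _) fun _ _ _ => zero_le' _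
    _ = ∑ j, Cone.single (n j * N⁻¹) (y j) := (sum_single_nsmul n hN' y).symm
    _ ≤ _ := Finset.sum_le_sum fun j _ => single_mono_left (by positivity) (hn j) _

end Splitting

/-! ### Monotonicity of finite barycenters. -/

section Monotone

lemma MVal.simple_apply {D : Type u} [PartialOrder D] {n : ℕ} (r : Fin n → I)
    (hr : ∑ i, (r i : ℝ) ≤ 1) (x : Fin n → D) (U : Opens (WithScott D)) :
    ((MVal.simple r hr x).1.toFun U : ℝ) =
      ∑ i, open Classical in if WithScott.toScott (x i) ∈ U then (r i : ℝ) else 0 := by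
  classical
  refine (combo_apply r hr _ U).trans (Finset.sum_congr rfl fun i _ => ?_)
  rw [dirac_apply]
  split_ifs <;> simp

/-- Finite barycenters are monotone in the simple valuation. -/
lemma IsFiniteBarycenter.mono {K : Type u} [PartialOrder K] [PointedBarycentricAlgebra K]
    [IsKegelspitze K] {s t : MVal K} {a b : K} (hs : IsFiniteBarycenter s a)
    (ht : IsFiniteBarycenter t b) (hst : s ≤ t) : a ≤ b := by
  classical
  obtain ⟨n, r, hr, x, rfl, rfl⟩ := hs
  obtain ⟨m, w, hw, y, rfl, rfl⟩ := ht
  refine le_of_forall_rsmul_le fun q hq0 hq1 => Cone.le_of_single_le ?_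
  have hq : Cone.single 1 (rsmul q (convexSum r x)) = Cone.single q (convexSum r x) := by
    rw [rsmul, Cone.single_rmix zero_le_one hq0.le hq1.le, Cone.single_pt, add_zero, one_mul]
  rw [hq, Cone.single_convexSum r hr x hq0.le, Cone.single_convexSum w hw y zero_le_one]
  simp only [one_mul]
  refine Cone.sum_single_le (fun i => (r i : ℝ)) (fun j => (w j : ℝ)) (fun i => (r i).2.1)
    (fun j => (w j).2.1) x y (fun J => ?_) hq0 hq1
  -- `U` contains every `x_i` with `i ∈ J`, while a `y_j` in `U` must lie above one of these `x_i`.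
  -- Comparing the two valuations on `U` therefore gives Hall's condition for `J`.
  let U := notBelow ({j | ¬ ∃ i ∈ J, x i ≤ y j} : Finset (Fin m)) y
  have hU : ((MVal.simple r hr x).1.toFun U : ℝ) ≤ (MVal.simple w hw y).1.toFun U := hst U
  rw [MVal.simple_apply, MVal.simple_apply] at hU
  refine le_trans ?_ (hU.trans ?_)
  · rw [← Finset.sum_filter]
    refine Finset.sum_le_sum_of_subset_of_nonneg (fun i hi => ?_) fun i _ _ => (r i).2.1
    rw [Finset.mem_filter]
    refine ⟨Finset.mem_univ i, fun j hj hle => ?_⟩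
    exact (Finset.mem_filter.1 hj).2 ⟨i, hi, hle⟩
  · refine Finset.sum_le_sum fun j _ => ?_
    by_cases hj : ∃ i ∈ J, x i ≤ y j
    · rw [if_pos hj]
      split_ifs
      · exact le_rfl
      · exact (w j).2.1
    · rw [if_neg hj, if_neg]
      exact fun h => h j (Finset.mem_filter.2 ⟨Finset.mem_univ j, hj⟩) le_rfl

end Monotone

/-! ### The Kegelspitze `M D` -/

/-- The suprema are taken one factor at a time, which leads to products `f x * g y` at different
points; directedness bounds these by a product at a single point. -/
lemma isLUB_mul {α : Type*} [Preorder α] {d : Set α} (h0 : d.Nonempty)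
    (hd : DirectedOn (· ≤ ·) d) {f g : α → ℝ} (hf : Monotone f) (hg : Monotone g)
    (hf0 : ∀ x, 0 ≤ f x) (hg0 : ∀ x, 0 ≤ g x) {a b : ℝ}
    (ha : IsLUB (f '' d) a) (hb : IsLUB (g '' d) b) :
    IsLUB ((fun x => f x * g x) '' d) (a * b) := by
  have ha0 : 0 ≤ a := by
    obtain ⟨x, hx⟩ := h0
    exact (hf0 x).trans (ha.1 ⟨x, hx, rfl⟩)
  refine ⟨?_, fun c hc => ?_⟩
  · rintro _ ⟨x, hx, rfl⟩
    exact mul_le_mul (ha.1 ⟨x, hx, rfl⟩) (hb.1 ⟨x, hx, rfl⟩) (hg0 x) ha0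
  · refine (isLUB_const_mul h0 ha0 hb).2 ?_
    rintro _ ⟨y, hy, rfl⟩
    change a * g y ≤ c
    rw [mul_comm]
    refine (isLUB_const_mul h0 (hg0 y) ha).2 ?_
    rintro _ ⟨x, hx, rfl⟩
    change g y * f x ≤ c
    rw [mul_comm]
    obtain ⟨z, hz, hxz, hyz⟩ := hd x hx y hy
    exact (mul_le_mul (hf hxz) (hg hyz) (hg0 y) (hf0 z)).trans (hc ⟨z, hz, rfl⟩)

section MVal

variable {D : Type u} [PartialOrder D]

lemma MVal.mix_eq (r : I) (ν ξ : MVal D) (U : Opens (WithScott D)) :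
    ((PointedBarycentricAlgebra.mix r ν ξ).1.toFun U : ℝ) =
      r * ν.1.toFun U + (1 - r) * ξ.1.toFun U := MVal.mix_apply r ν ξ U

lemma MVal.pt_apply (U : Opens (WithScott D)) :
    (((pt : MVal D)).1.toFun U : ℝ) = 0 := rfl

/-- This makes the facts on convex sums and on scalar multiplication available in `M D` itself,
where a simple valuation is a convex sum of Dirac valuations. -/
instance : IsKegelspitze (MVal D) where
  mix_scottContinuous r := by
    refine MVal.scottContinuous_of_pointwise fun U d h0 hd a ha => ?_
    simp only [MVal.mix_eq]
    have h1 : ScottContinuous fun p : MVal D × MVal D => (p.1.1.toFun U : ℝ) :=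
      ScottContinuous.fst.comp (scottContinuous_coe.2 (MVal.eval_scottContinuous U))
    have h2 : ScottContinuous fun p : MVal D × MVal D => (p.2.1.toFun U : ℝ) :=
      ScottContinuous.snd.comp (scottContinuous_coe.2 (MVal.eval_scottContinuous U))
    have hr := sub_nonneg.2 r.2.2
    exact isLUB_add hd (h1.monotone.const_mul r.2.1) (h2.monotone.const_mul hr)
      (isLUB_const_mul h0 r.2.1 (h1 h0 hd ha)) (isLUB_const_mul h0 hr (h2 h0 hd ha))
  smul_scottContinuous := by
    refine MVal.scottContinuous_of_pointwise fun U d h0 hd a ha => ?_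
    simp only [MVal.mix_eq, MVal.pt_apply, mul_zero, add_zero]
    have h1 : ScottContinuous fun p : I × MVal D => (p.1 : ℝ) :=
      scottContinuous_coe.2 ScottContinuous.fst
    have h2 : ScottContinuous fun p : I × MVal D => (p.2.1.toFun U : ℝ) :=
      ScottContinuous.snd.comp (scottContinuous_coe.2 (MVal.eval_scottContinuous U))
    exact isLUB_mul h0 hd h1.monotone h2.monotone (fun p => p.1.2.1) (fun p => (p.2.1.toFun U).2.1)
      (h1 h0 hd ha) (h2 h0 hd ha)

lemma MVal.simple_eq_convexSum {n : ℕ} (r : Fin n → I) (hr : ∑ i, (r i : ℝ) ≤ 1) (x : Fin n → D) :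
    MVal.simple r hr x = convexSum r fun i => MVal.unit (x i) :=
  MVal.ext' fun U => (combo_apply r hr _ U).trans
    (convexSum_apply r hr (fun i => MVal.unit (x i)) U).symm

lemma MVal.mult_simple {n : ℕ} (r : Fin n → I) (hr : ∑ i, (r i : ℝ) ≤ 1) (ν : Fin n → MVal D) :
    MVal.mult (MVal.simple r hr ν) = convexSum r ν :=
  MVal.ext' fun U => (multInt_simple r hr (fun i => WithScott.toScott (ν i)) U).trans
    (convexSum_apply r hr ν U).symm

lemma MVal.induction {P : MVal D → Prop}
    (simple : ∀ (n : ℕ) (r : Fin n → I) (hr : ∑ i, (r i : ℝ) ≤ 1) (x : Fin n → D),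
      P (MVal.simple r hr x))
    (sup : ∀ d : Set (MVal D), d.Nonempty → DirectedOn (· ≤ ·) d → (∀ ξ ∈ d, P ξ) →
      ∀ ν, IsLUB d ν → P ν) (ν : MVal D) : P ν := by
  obtain ⟨ν, hν⟩ := ν
  refine MSet_induction (P := fun ν => ∀ hν : ν ∈ MSet D, P ⟨ν, hν⟩) ?_ ?_ hν hν
  · rintro _ ⟨n, r, hr, x, rfl⟩ _
    exact simple n r hr x
  · intro d hdM h0 hd hP a ha haM
    refine sup {ξ | ξ.1 ∈ d} ?_ ?_ (fun ξ hξ => hP ξ.1 hξ ξ.2) ⟨a, haM⟩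
      ⟨fun ξ hξ => ha.1 hξ, fun c hc => ha.2 fun ξ hξ => hc (a := ⟨ξ, hdM hξ⟩) hξ⟩
    · obtain ⟨ξ, hξ⟩ := h0
      exact ⟨⟨ξ, hdM hξ⟩, hξ⟩
    · intro x hx y hy
      obtain ⟨z, hz, h1, h2⟩ := hd x.1 hx y.1 hy
      exact ⟨⟨z, hdM hz⟩, hz, h1, h2⟩

/-- Two Scott-continuous maps on `M D` agree if they agree on the simple valuations. -/
lemma MVal.eq_of_simple {E : Type*} [PartialOrder E] {f g : MVal D → E} (hf : ScottContinuous f)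
    (hg : ScottContinuous g)
    (h : ∀ (n : ℕ) (r : Fin n → I) (hr : ∑ i, (r i : ℝ) ≤ 1) (x : Fin n → D),
      f (MVal.simple r hr x) = g (MVal.simple r hr x)) (ν : MVal D) : f ν = g ν := by
  refine MVal.induction (P := fun ν => f ν = g ν) h (fun d h0 hd hP ν hν => ?_) ν
  refine (hf h0 hd hν).unique ?_
  rw [image_congr hP]
  exact hg h0 hd hν

end MVal

/-! ### Approximation of simple valuations -/

section Approximation

variable {D : Type u} [PartialOrder D] [IsDomainDcpo D]

/-- An open `U` matters only through the set `J` of the indices with `x'_i ∈ U`, and the points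
way-above some `x'_i` with `i ∈ J` form an open subset of `U`. So finitely many lower bounds
suffice; each is attained in the directed set because `q < 1` makes it strict, and one member then
serves for all `J`. -/
lemma wayBelow_simple {n : ℕ} (r : Fin n → I) (hr : ∑ i, (r i : ℝ) ≤ 1) {x' x : Fin n → D}
    (hx : ∀ i, WayBelow (x' i) (x i)) {q : I} (hq : q < 1) :
    WayBelow (mix q (MVal.simple r hr x') pt) (MVal.simple r hr x) := by
  classical
  intro A hA0 hA ξ hξ hle
  have hq' : (q : ℝ) < 1 := hq
  have key : ∀ J : Finset (Fin n), ∃ a ∈ A, q * ∑ i ∈ J, (r i : ℝ) ≤ a.1.toFun (wayAbove J x') := by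
    intro J
    -- When the weight over `J` is zero, scaling by `q` gives no strict inequality, but the bound is
    -- trivial.
    rcases (Finset.sum_nonneg fun i (_ : i ∈ J) => (r i).2.1).eq_or_lt with h0 | h0
    · obtain ⟨a, ha⟩ := hA0
      refine ⟨a, ha, ?_⟩
      rw [← h0, mul_zero]
      exact (a.1.toFun _).2.1
    · have h1 : ∑ i ∈ J, (r i : ℝ) ≤ ξ.1.toFun (wayAbove J x') := by
        have h2 : ((MVal.simple r hr x).1.toFun (wayAbove J x') : ℝ) ≤
          ξ.1.toFun (wayAbove J x') := hle _
        refine le_trans ?_ h2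
        rw [MVal.simple_apply, ← Finset.sum_filter]
        refine Finset.sum_le_sum_of_subset_of_nonneg (fun i hi => ?_) fun i _ _ => (r i).2.1
        exact Finset.mem_filter.2 ⟨Finset.mem_univ i, i, hi, hx i⟩
      have h2 : q * ∑ i ∈ J, (r i : ℝ) < ξ.1.toFun (wayAbove J x') := by nlinarith
      obtain ⟨_, ⟨a, ha, rfl⟩, h3, -⟩ := (MVal.isLUB_pointwise hA0 hA hξ _).exists_between h2
      exact ⟨a, ha, h3.le⟩
  choose a ha hqa using key
  obtain ⟨b, hb, hab⟩ : ∃ b ∈ A, ∀ J, a J ≤ b := by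
    have : Nonempty A := hA0.to_subtype
    obtain ⟨b, hab⟩ := (directedOn_iff_directed.1 hA).finite_le fun J => ⟨a J, ha J⟩
    exact ⟨b, b.2, hab⟩
  refine ⟨b, hb, fun U => ?_⟩
  let J : Finset (Fin n) := {i | WithScott.toScott (x' i) ∈ U}
  have hJU : wayAbove J x' ≤ U := by
    rintro y ⟨i, hi, hiy⟩
    exact IsScott.isUpperSet_of_isOpen (α := WithScott D) (D := univ) U.isOpen
      (show WithScott.toScott (x' i) ≤ y from hiy.le) (Finset.mem_filter.1 hi).2
  have h1 : ((mix q (MVal.simple r hr x') pt : MVal D).1.toFun U : ℝ) = q * ∑ i ∈ J, (r i : ℝ) := by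
    rw [MVal.mix_eq, MVal.pt_apply, mul_zero, add_zero, MVal.simple_apply, Finset.sum_filter]
  change ((mix q (MVal.simple r hr x') pt : MVal D).1.toFun U : ℝ) ≤ b.1.toFun U
  rw [h1]
  exact (hqa J).trans ((hab J _).trans (b.1.toFun_mono hJU))

/-- The scale factors below `1` together with the points componentwise way-below `x`. -/
def approximants {n : ℕ} (x : Fin n → D) : Set (I × (Fin n → D)) :=
  {q : I | q < 1} ×ˢ {x' | ∀ i, WayBelow (x' i) (x i)}

lemma approximants_directed {n : ℕ} (x : Fin n → D) :
    (approximants x).Nonempty ∧ DirectedOn (· ≤ ·) (approximants x) ∧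
      IsLUB (approximants x) (1, x) := by
  have hx := fun i => wayBelow_directed (x i)
  have hI : {q : I | q < 1}.Nonempty := ⟨0, show (0 : I) < 1 from zero_lt_one⟩
  have hne : {x' : Fin n → D | ∀ i, WayBelow (x' i) (x i)}.Nonempty := by
    choose y hy using fun i => (hx i).1
    exact ⟨y, hy⟩
  refine ⟨hI.prod hne, ?_, ?_⟩
  · rintro ⟨p, y⟩ ⟨hp, hy⟩ ⟨q, z⟩ ⟨hq, hz⟩
    choose w hw hyw hzw using fun i => (hx i).2.1 (y i) (hy i) (z i) (hz i)
    exact ⟨(max p q, w), ⟨show max p q < 1 from max_lt hp hq, hw⟩, ⟨le_max_left _ _, hyw⟩,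
      ⟨le_max_right _ _, hzw⟩⟩
  · rw [isLUB_prod, approximants, fst_image_prod _ hne, snd_image_prod hI]
    refine ⟨isLUB_unitInterval_lt_one, isLUB_pi.2 fun i => ?_⟩
    convert (hx i).2.2 using 1
    ext y
    constructor
    · rintro ⟨x', hx', rfl⟩
      exact hx' i
    · intro hy
      obtain ⟨x', hx'⟩ := hne
      -- Altering one coordinate of some approximant shows that the projection to the coordinate `i`
      -- is onto the set of points way-below `x i`.
      refine ⟨Function.update x' i y, fun j => ?_, Function.update_self ..⟩
      by_cases hj : j = i
      · subst hj; rwa [Function.update_self]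
      · rw [Function.update_of_ne hj]; exact hx' j

/-- Scaled convex sums are suprema of their approximants. -/
lemma isLUB_convexSum {K : Type*} [PartialOrder K] [PointedBarycentricAlgebra K]
    [IsKegelspitze K] {n : ℕ} (r : Fin n → I) (x : Fin n → D) {f : D → K}
    (hf : ScottContinuous f) :
    IsLUB ((fun p : I × (Fin n → D) => mix p.1 (convexSum r fun i => f (p.2 i)) pt) ''
      approximants x) (convexSum r fun i => f (x i)) := by
  obtain ⟨h0, hd, hx⟩ := approximants_directed x
  have hpi : ScottContinuous fun (y : Fin n → D) i => f (y i) := by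
    intro e he0 hed a ha
    rw [isLUB_pi] at ha ⊢
    intro i
    rw [image_image]
    have := hf (he0.image (Function.eval i)) (directedOn_image.2 (hed.mono fun {_ _} h => h i))
      (ha i)
    rwa [image_image] at this
  have h1 : ScottContinuous fun p : I × (Fin n → D) => convexSum r fun i => f (p.2 i) :=
    ScottContinuous.snd.comp (hpi.comp (convexSum_scottContinuous r))
  have := ((ScottContinuous.fst.prodMk h1).comp IsKegelspitze.smul_scottContinuous) h0 hd hx
  simpa only [Function.comp_def, mix_one] using this

end Approximation

/-! ### Finite barycenters -/

section FiniteBarycenter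

variable {K : Type u} [PartialOrder K] [PointedBarycentricAlgebra K]

lemma IsFiniteBarycenter.unit (x : K) : IsFiniteBarycenter (MVal.unit x) x := by
  have hr : ∑ i : Fin 1, (((fun _ => 1 : Fin 1 → I) i : I) : ℝ) ≤ 1 := by simp
  refine ⟨1, fun _ => 1, hr, fun _ => x, ?_, (if_pos rfl).symm⟩
  rw [MVal.simple_eq_convexSum]
  exact (if_pos rfl).symm

lemma IsFiniteBarycenter.pt : IsFiniteBarycenter (pt : MVal K) (pt : K) :=
  ⟨0, Fin.elim0, by simp, Fin.elim0,
    (MVal.simple_eq_convexSum (D := K) Fin.elim0 (by simp) Fin.elim0).symm, rfl⟩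

lemma append_weights {n m : ℕ} {r : Fin n → I} (hr : ∑ i, (r i : ℝ) ≤ 1) {w : Fin m → I}
    (hw : ∑ i, (w i : ℝ) ≤ 1) (p : I) :
    ∑ i, ((Fin.append (fun i => p * r i) (fun j => σ p * w j) i : I) : ℝ) ≤ 1 := by
  simp only [Fin.sum_univ_add, Fin.append_left, Fin.append_right, Icc.coe_mul, ← Finset.mul_sum,
    unitInterval.coe_symm_eq]
  nlinarith [p.2.1, p.2.2]

variable [IsKegelspitze K]

lemma mix_scottContinuous_left (p : I) (b : K) : ScottContinuous fun a => mix p a b :=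
  (ScottContinuous.id.prodMk (ScottContinuous.const b)).comp
    (IsKegelspitze.mix_scottContinuous p)

lemma mix_scottContinuous_right (p : I) (a : K) : ScottContinuous fun b => mix p a b :=
  ((ScottContinuous.const a).prodMk ScottContinuous.id).comp
    (IsKegelspitze.mix_scottContinuous p)

/-- The weights are concatenated. The resulting identity in `K` is verified in the cone, where both
sides are the same sum, and is brought back by antisymmetry. -/
lemma IsFiniteBarycenter.mix (p : I) {s t : MVal K} {a b : K} (hs : IsFiniteBarycenter s a)
    (ht : IsFiniteBarycenter t b) : IsFiniteBarycenter (mix p s t) (mix p a b) := by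
  classical
  obtain ⟨n, r, hr, x, rfl, rfl⟩ := hs
  obtain ⟨m, w, hw, y, rfl, rfl⟩ := ht
  refine ⟨n + m, Fin.append (fun i => p * r i) fun j => σ p * w j, append_weights hr hw p,
    Fin.append x y, MVal.ext' fun U => ?_, ?_⟩
  · simp only [MVal.mix_eq, MVal.simple_apply, Fin.sum_univ_add, Fin.append_left, Fin.append_right,
      Icc.coe_mul, unitInterval.coe_symm_eq, Finset.mul_sum, mul_ite, mul_zero]
  · have h : Cone.single 1 (PointedBarycentricAlgebra.mix p (convexSum r x) (convexSum w y)) =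
        Cone.single 1 (convexSum (Fin.append (fun i => p * r i) fun j => σ p * w j)
          (Fin.append x y)) := by
      rw [Cone.single_convexSum _ (append_weights hr hw p) _ zero_le_one, mix_eq_rmix,
        Cone.single_rmix zero_le_one p.2.1 p.2.2, one_mul, one_mul,
        Cone.single_convexSum r hr x p.2.1, Cone.single_convexSum w hw y (sub_nonneg.2 p.2.2)]
      simp only [Fin.sum_univ_add, Fin.append_left, Fin.append_right, Icc.coe_mul,
        unitInterval.coe_symm_eq, one_mul]
    exact le_antisymm (Cone.le_of_single_le h.le) (Cone.le_of_single_le h.ge)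

/-- The simple valuations form a basis of `M K`. -/
lemma simple_basis [IsDomainDcpo K] (ν : MVal K) :
    BasisAt {s : MVal K | ∃ b, IsFiniteBarycenter s b} ν := by
  -- Any directed set of simple valuations way-below `ν` with supremum `ν` is cofinal among all
  -- simple valuations way-below `ν`, so exhibiting one such set is enough.
  have key : ∀ (ν : MVal K) (A : Set (MVal K)), A.Nonempty → DirectedOn (· ≤ ·) A → IsLUB A ν →
      (∀ s ∈ A, (∃ b, IsFiniteBarycenter s b) ∧ WayBelow s ν) →
      BasisAt {s : MVal K | ∃ b, IsFiniteBarycenter s b} ν := by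
    intro ν A h0 hd hν hA
    refine ⟨?_, ?_, fun s hs => hs.2.le, fun c hc => hν.2 fun s hs => hc (hA s hs)⟩
    · obtain ⟨s, hs⟩ := h0
      exact ⟨s, hA s hs⟩
    · intro s hs t ht
      obtain ⟨s', hs', hss⟩ := hs.2 A h0 hd ν hν le_rfl
      obtain ⟨t', ht', htt⟩ := ht.2 A h0 hd ν hν le_rfl
      obtain ⟨e, he, hse, hte⟩ := hd s' hs' t' ht'
      exact ⟨e, hA e he, hss.trans hse, htt.trans hte⟩
  refine MVal.induction (P := BasisAt _) (fun n r hr x => ?_) (fun d h0 hd hP ν hν => ?_) ν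
  · have hL := isLUB_convexSum r x (MVal.unit_scottContinuous (D := K))
    obtain ⟨h0, hd, hx⟩ := approximants_directed x
    simp only [← MVal.simple_eq_convexSum r hr] at hL
    refine key _ _ (h0.image _) (directedOn_image.2 (hd.mono fun {p q} hpq => ?_)) hL ?_
    · refine IsKegelspitze.smul_scottContinuous.monotone (Prod.mk_le_mk.2 ⟨hpq.1, ?_⟩)
      change MVal.simple r hr p.2 ≤ MVal.simple r hr q.2
      rw [MVal.simple_eq_convexSum, MVal.simple_eq_convexSum]
      refine (convexSum_scottContinuous r).monotone fun i => ?_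
      exact MVal.unit_scottContinuous.monotone (hpq.2 i)
    · rintro _ ⟨⟨q, x'⟩, ⟨hq, hx'⟩, rfl⟩
      exact ⟨⟨_, IsFiniteBarycenter.mix q ⟨n, r, hr, x', rfl, rfl⟩ IsFiniteBarycenter.pt⟩,
        wayBelow_simple r hr hx' hq⟩
  · obtain ⟨h0', hd', hν'⟩ := directed_iUnion_wayBelow h0 hd hP hν
    exact key _ _ h0' hd' hν' fun s ⟨ξ, hξ, hs, hsξ⟩ => ⟨hs, hsξ.trans_le (hν.1 hξ)⟩

instance [IsDomainDcpo K] : IsDomainDcpo (MVal K) where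
  exists_basis := ⟨_, simple_basis⟩

end FiniteBarycenter

/-! ### The barycenter map -/

section Barycenter

variable {K : Type u} [PartialOrder K] [PointedBarycentricAlgebra K] [IsKegelspitze K]
  [IsDomainDcpo K]

/-- The simple valuations way-below `ν` are directed, and by monotonicity so are their barycenters.
-/
lemma exists_barycenter (ν : MVal K) :
    ∃ b, IsLUB {b : K | ∃ s, WayBelow s ν ∧ IsFiniteBarycenter s b} b := by
  obtain ⟨⟨s, ⟨a, ha⟩, hs⟩, hd, -⟩ := simple_basis ν
  refine IsDcpo.exists_isLUB _ ⟨a, s, hs, ha⟩ ?_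
  rintro b ⟨t, ht, hb⟩ c ⟨u, hu, hc⟩
  obtain ⟨v, ⟨⟨e, he⟩, hv⟩, htv, huv⟩ := hd t ⟨⟨b, hb⟩, ht⟩ u ⟨⟨c, hc⟩, hu⟩
  exact ⟨e, ⟨v, hv, he⟩, hb.mono he htv, hc.mono he huv⟩

/-- The barycenter of a valuation. -/
def barycenter (ν : MVal K) : K := (exists_barycenter ν).choose

lemma barycenter_isBarycenterMap : IsBarycenterMap (barycenter (K := K)) :=
  fun ν => (exists_barycenter ν).choose_spec

/-- `M K` is a domain, so a simple valuation way-below the supremum of a directed set is already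
way-below one of its members. -/
lemma barycenter_scottContinuous : ScottContinuous (barycenter (K := K)) := by
  intro d h0 hd ν hν
  refine ⟨?_, fun c hc => (barycenter_isBarycenterMap ν).2 ?_⟩
  · rintro _ ⟨ξ, hξ, rfl⟩
    refine (barycenter_isBarycenterMap ξ).2 ?_
    rintro b ⟨s, hs, hb⟩
    exact (barycenter_isBarycenterMap ν).1 ⟨s, hs.trans_le (hν.1 hξ), hb⟩
  · rintro b ⟨s, hs, hb⟩
    obtain ⟨ξ, hξ, hsξ⟩ := hs.exists_of_isLUB h0 hd hν
    exact ((barycenter_isBarycenterMap ξ).1 ⟨s, hsξ, hb⟩).trans (hc ⟨ξ, hξ, rfl⟩)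

/-- One inequality is monotonicity. For the other, the convex sum is the supremum of its scaled
approximants, each of which is the barycenter of a simple valuation way-below `s`. In particular the
convex sum does not depend on the representation of `s`. -/
lemma IsFiniteBarycenter.barycenter_eq {s : MVal K} {b : K} (h : IsFiniteBarycenter s b) :
    barycenter s = b := by
  refine le_antisymm ((barycenter_isBarycenterMap s).2 ?_) ?_
  · rintro a ⟨t, ht, ha⟩
    exact ha.mono h ht.le
  · obtain ⟨n, r, hr, x, rfl, rfl⟩ := h
    refine (isLUB_convexSum r x ScottContinuous.id).2 ?_
    rintro _ ⟨⟨q, x'⟩, ⟨hq, hx'⟩, rfl⟩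
    exact (barycenter_isBarycenterMap _).1 ⟨_, wayBelow_simple r hr hx' hq,
      IsFiniteBarycenter.mix q ⟨n, r, hr, x', rfl, rfl⟩ IsFiniteBarycenter.pt⟩

lemma barycenter_mix_simple (p : I) {s t : MVal K} {a b : K} (hs : IsFiniteBarycenter s a)
    (ht : IsFiniteBarycenter t b) :
    barycenter (mix p s t) = mix p (barycenter s) (barycenter t) := by
  rw [(hs.mix p ht).barycenter_eq, hs.barycenter_eq, ht.barycenter_eq]

lemma barycenter_mix_of_simple (p : I) {s : MVal K} {a : K} (hs : IsFiniteBarycenter s a)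
    (ξ : MVal K) : barycenter (mix p s ξ) = mix p (barycenter s) (barycenter ξ) := by
  have h1 : ScottContinuous fun ξ : MVal K => barycenter (mix p s ξ) :=
    (mix_scottContinuous_right p s).comp barycenter_scottContinuous
  have h2 : ScottContinuous fun ξ : MVal K => mix p (barycenter s) (barycenter ξ) :=
    barycenter_scottContinuous.comp (mix_scottContinuous_right p _)
  exact MVal.eq_of_simple h1 h2
    (fun n r hr x => barycenter_mix_simple p hs ⟨n, r, hr, x, rfl, rfl⟩) ξ

lemma barycenter_mix (p : I) (ν ξ : MVal K) :
    barycenter (mix p ν ξ) = mix p (barycenter ν) (barycenter ξ) := by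
  have h1 : ScottContinuous fun ν : MVal K => barycenter (mix p ν ξ) :=
    (mix_scottContinuous_left p ξ).comp barycenter_scottContinuous
  have h2 : ScottContinuous fun ν : MVal K => mix p (barycenter ν) (barycenter ξ) :=
    ScottContinuous.comp (g := fun a => mix p a (barycenter ξ)) barycenter_scottContinuous
      (mix_scottContinuous_left p _)
  refine MVal.eq_of_simple h1 h2 (fun n r hr x => ?_) ν
  have hs : IsFiniteBarycenter (MVal.simple r hr x) (convexSum r x) := ⟨n, r, hr, x, rfl, rfl⟩
  exact barycenter_mix_of_simple p hs ξ

lemma barycenter_isLinear : IsLinear (barycenter (K := K)) :=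
  ⟨IsFiniteBarycenter.pt.barycenter_eq, barycenter_mix⟩

lemma barycenter_unit (x : K) : barycenter (MVal.unit x) = x :=
  (IsFiniteBarycenter.unit x).barycenter_eq

/-- On a simple valuation `∑ r_i δ_{ν_i}` of valuations, the multiplication gives the convex sum `∑
r_i ν_i`, and linearity sends it to `∑ r_i β(ν_i)`, the barycenter of the image `∑ r_i δ_{β(ν_i)}`.
-/
lemma barycenter_mult (ϖ : MVal (MVal K)) :
    barycenter (MVal.mult ϖ) =
      barycenter (MVal.map barycenter barycenter_scottContinuous ϖ) := by
  refine MVal.eq_of_simple (f := fun ϖ => barycenter (MVal.mult ϖ))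
    (MVal.mult_scottContinuous.comp barycenter_scottContinuous)
    ((MVal.map_scottContinuous _ _).comp barycenter_scottContinuous) (fun n r hr ν => ?_) ϖ
  have h : IsFiniteBarycenter
      (MVal.map barycenter barycenter_scottContinuous (MVal.simple r hr ν))
      (convexSum r fun i => barycenter (ν i)) := ⟨n, r, hr, fun i => barycenter (ν i), rfl, rfl⟩
  rw [Function.comp_apply, h.barycenter_eq, MVal.mult_simple, barycenter_isLinear.map_convexSum]

end Barycenter

end

end Kegel

open Kegel
theorem mainTheorem10 (K : Type u) [PartialOrder K] [PointedBarycentricAlgebra K]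
    [IsKegelspitze K] [IsDomainDcpo K] :
    ∃ (β : MVal K → K) (hβ : ScottContinuous β),
      IsBarycenterMap β ∧
      (∀ (s : MVal K) (b : K), IsFiniteBarycenter s b → β s = b) ∧
      IsLinear β ∧
      IsEilenbergMooreAlgebra valuationMonad.{u} (DCPO.mk K) (DCPO.Hom.mk β hβ) :=
  ⟨barycenter, barycenter_scottContinuous, barycenter_isBarycenterMap,
    fun _ _ h => h.barycenter_eq, barycenter_isLinear,
    DCPO.Hom.ext (funext fun x : K => barycenter_unit x),
    DCPO.Hom.ext (funext fun ϖ : MVal (MVal K) => barycenter_mult ϖ)⟩
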